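/- Let $E$ be a real vector space of dimension $n\ge 1$ with norm $\|x\|^2=\langle Bx,x\rangle$, where $B:E\to E^*$ is linear, symmetric and positive definite, and let $\|s\|_*^2=\langle s,B^{-1}s\rangle$ on $E^*$. Let $\nu\in[0,1]$ and $L>0$. Let $f:E\to\mathbb R$ be bounded below, with $f^*=\inf f$, and differentiable with $\|\nabla f(y)-\nabla f(x)\|_*\le L\|y-x\|^\nu$ for all $x,y\in E$. For $\mu>0$ put $$f_\mu(x)=\frac1\kappa\int_E f(x+\mu u)e^{-\|u\|^2/2}\,du,\qquad \kappa=\int_E e^{-\|u\|^2/2}\,du .$$ Let $\tilde f:E\to\mathbb R$ be a (measurable) inexact oracle with noise level $\delta>0$: $|f(x)-\tilde f(x)|\le\delta$ for all $x\in E$. From $x_0\in E$ consider the process $$x_{k+1}=x_k-h\,B^{-1}g_\mu(x_k,u_k),\qquad g_\mu(x,u)=\frac{\tilde f(x+\mu u)-\tilde f(x)}{\mu}\,Bu,$$ where $u_0,u_1,\dots$ are independent standard Gaussian vectors in $E$ (density $\kappa^{-1}e^{-\|u\|^2/2}$), and $$h=\frac{D}{80(n+4)A_1},\qquad A_1=\frac{L}{\mu^{1-\nu}}n^{\frac{1+\nu}2},\qquad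 D=\mu^{1-\nu}.$$ **Theorem.** Fix $\nu\in[0,1]$, $L>0$, $\Delta\ge0$ and $\bar\varepsilon>0$; all constants hidden in $O$ and $\Theta$ below are positive and depend on these four numbers only. For every $n\ge1$ and $\varepsilon\in(0,\bar\varepsilon]$ there is $\mu\in(0,1)$, depending only on $n$, $\varepsilon$ and the four fixed numbers, such that for all $E$ and $f$ as above the function $f_\mu$ is well defined and differentiable, and, for all $x\in E$, $$|f_\mu(x)-f(x)|\le\frac{L}{1+\nu}\mu^{1+\nu}n^{\frac{1+\nu}2}=\Theta\!\left(\frac{\varepsilon}{n^{\frac{1+\nu}2}}\right),$$ and such that, for all $x_0$ with $f(x_0)-f^*\le\Delta$ and all $\tilde f$ as above with $$\delta<\frac{\mu^{\frac{5-\nu}2}}{n^{\frac{3-\nu}4}}=O\!\left(\frac{\varepsilon^{\frac{5-\nu}{2(1+\nu)}}}{n^{\frac{13-3\nu}4}}\right),$$ the expectations below are finite and $$\min_{0\le k\le N-1}\mathbb E\,\|\nabla f_\mu(x_k)\|_*^2\le\varepsilon\qquad\text{after}\qquad N=O\!\left(\frac{n^{\frac{7-3\nu}2}}{\varepsilon^{\frac{3-\nu}{1+\nu}}}\right)$$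 steps; more precisely, there is a constant $c$, depending on the four fixed numbers only, such that this holds for every integer $N\ge c\,n^{\frac{7-3\nu}2}/\varepsilon^{\frac{3-\nu}{1+\nu}}$. -/

import Mathlib

open MeasureTheory ProbabilityTheory

universe u v

noncomputable section

/-! The `n`-dimensional space `E` with a positive definite operator `B : E → E*` and the norm
`‖x‖² = ⟨Bx, x⟩` is a finite-dimensional real inner product space `E`: its inner product is
`⟨Bx, y⟩`, so `B` is the Riesz isomorphism `InnerProductSpace.toDual ℝ E`, and the norm of
`StrongDual ℝ E` is the dual norm, `‖s‖² = ⟨s, B⁻¹ s⟩`. Gradients are elements of the dual space,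
that is, Fréchet derivatives. -/

namespace ZerothOrder

section Definitions

variable {E : Type*} [NormedAddCommGroup E] [InnerProductSpace ℝ E] [FiniteDimensional ℝ E]
  [MeasurableSpace E] [BorelSpace E]

/-- `f` is differentiable, and its gradient is `ν`-Hölder continuous with constant `L` with respect
to the norm of `E` and the dual norm. -/
def HasHolderGradient (f : E → ℝ) (ν L : ℝ) : Prop :=
  Differentiable ℝ f ∧ ∀ x y : E, ‖fderiv ℝ f y - fderiv ℝ f x‖ ≤ L * ‖y - x‖ ^ ν

/-- `ft` is an inexact zeroth-order oracle for `f` with noise level `δ > 0`. The noise is arbitrary,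
up to measurability, so it may be biased and discontinuous. -/
def IsInexactOracle (f ft : E → ℝ) (δ : ℝ) : Prop :=
  0 < δ ∧ Measurable ft ∧ ∀ x : E, |f x - ft x| ≤ δ

/-- The normalizing constant `κ = ∫ exp (-‖u‖² / 2) du`. -/
def gaussNorm (E : Type*) [NormedAddCommGroup E] [InnerProductSpace ℝ E] [FiniteDimensional ℝ E]
    [MeasurableSpace E] [BorelSpace E] : ℝ :=
  ∫ u : E, Real.exp (-(1 / 2) * ‖u‖ ^ 2)

/-- The Gaussian approximation `f_μ (x) = κ⁻¹ ∫ f (x + μ u) exp (-‖u‖² / 2) du`. -/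
def smoothed (f : E → ℝ) (μ : ℝ) (x : E) : ℝ :=
  (gaussNorm E)⁻¹ * ∫ u : E, f (x + μ • u) * Real.exp (-(1 / 2) * ‖u‖ ^ 2)

/-- The random gradient estimation `g_μ (x, u) = ((ft (x + μ u) - ft x) / μ) B u`. -/
def gradEst (ft : E → ℝ) (μ : ℝ) (x u : E) : StrongDual ℝ E :=
  ((ft (x + μ • u) - ft x) / μ) • InnerProductSpace.toDual ℝ E u

/-- The iterates `x_{k+1} = x_k - h_k B⁻¹ g_μ (x_k, u_k)` from `x₀`, for step sizes `h` and a
sequence of directions `u`. -/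
def iterate (ft : E → ℝ) (μ : ℝ) (h : ℕ → ℝ) (x₀ : E) (u : ℕ → E) : ℕ → E
  | 0 => x₀
  | k + 1 => iterate ft μ h x₀ u k -
      h k • (InnerProductSpace.toDual ℝ E).symm (gradEst ft μ (iterate ft μ h x₀ u k) (u k))

end Definitions

/-- The Lipschitz constant `A₁ = L n^((1+ν)/2) / μ^(1-ν)` of the gradient of `f_μ`. -/
def smoothConst (ν L : ℝ) (n : ℕ) (μ : ℝ) : ℝ :=
  L * (n : ℝ) ^ ((1 + ν) / 2) / μ ^ (1 - ν)

/-- The step size `h = D / (80 (n + 4) A₁)` with step parameter `D = μ^(1-ν)`. -/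
def stepSize (ν L : ℝ) (n : ℕ) (μ : ℝ) : ℝ :=
  μ ^ (1 - ν) / (80 * ((n : ℝ) + 4) * smoothConst ν L n μ)

/-- The bound `ε_f = L / (1+ν) μ^(1+ν) n^((1+ν)/2)` for the functional gap `|f_μ - f|`. -/
def gapBound (ν L : ℝ) (n : ℕ) (μ : ℝ) : ℝ :=
  L / (1 + ν) * μ ^ (1 + ν) * (n : ℝ) ^ ((1 + ν) / 2)

/-- The strict upper bound `μ^((5-ν)/2) / n^((3-ν)/4)` for the noise level. -/
def noiseBound (ν : ℝ) (n : ℕ) (μ : ℝ) : ℝ :=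
  μ ^ ((5 - ν) / 2) / (n : ℝ) ^ ((3 - ν) / 4)

end ZerothOrder

end

noncomputable section

open Filter Topology
open scoped RealInnerProductSpace ENNReal NNReal

set_option linter.unusedSectionVars false

namespace ZerothOrder

/-! ### Gaussian tools: density, translation formula, moment bounds -/

section Gaussian

variable {E : Type*} [NormedAddCommGroup E] [InnerProductSpace ℝ E] [FiniteDimensional ℝ E]
  [MeasurableSpace E] [BorelSpace E]

/-! ### The standard Gaussian measure and its density -/

/-! Even when ∇f is merely Hölder, or for ν = 0 only of bounded oscillation, Gaussian averaging
moves derivatives onto the density, so ∇f_μ is Lipschitz with constant A₁ (`smoothed_lipschitz`).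
The method is thus a randomized gradient descent on the smooth function f_μ, and the descent
inequality applies to each step x ↦ x - h s u, where s is the difference quotient of the oracle.

Two expectations are needed. To first order, E[s ⟨∇f_μ, u⟩] equals ‖∇f_μ‖² for the exact oracle by
Gaussian integration by parts; noise changes s by at most 2δ/μ, which costs a quarter of ‖∇f_μ‖²
plus 4(δ/μ)² (`le_integral_oracleSlope_mul_fderiv`). To second order, E[s²‖u‖²] is at most
16n‖∇f_μ‖² plus error terms (`integral_oracleSlope_sq_mul_le`). Since A₁h = μ^(1-ν)/(80(n+4)), the
quadratic term absorbs only a small fraction of the first-order gain, and each step decreases f_μ on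
average by (h/2)‖∇f_μ‖² up to h times `stepError` (`integral_smoothed_oracleStep_le`).

Each iterate is independent of the next direction, so this estimate integrates along the process and
telescopes against the lower bound f* of f_μ (`sum_integral_norm_fderiv_sq_le`). With (μn)^(1+ν) = K
proportional to ε, the factor μ^(1-ν) in the step size turns the smoothing error into a multiple of
K, and the noise bound does the same for the noise (`stepError_le`). The error is then at most ε/4,
and the lower bound on h (`le_stepSize_smoothingParam`) gives the number of steps. -/

lemma integrable_exp_neg_half_sq_norm :
    Integrable (fun w : E => Real.exp (-(1 / 2) * ‖w‖ ^ 2)) := by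
  have h := GaussianFourier.integrable_cexp_neg_mul_sq_norm_add (V := E) (b := ((1 / 2 : ℝ) : ℂ))
    (by simp) 0 0
  convert h.re using 2 with w
  simp only [inner_zero_left, Complex.ofReal_zero, mul_zero, add_zero]
  rw [← Complex.ofReal_neg, ← Complex.ofReal_pow, ← Complex.ofReal_mul, ← Complex.ofReal_exp]
  rfl

lemma gaussNorm_pos : 0 < gaussNorm E := by
  rw [gaussNorm, GaussianFourier.integral_rexp_neg_mul_sq_norm (by norm_num)]
  positivity

/-- The density of the standard Gaussian measure. -/
def gaussDensity (u : E) : ℝ := (gaussNorm E)⁻¹ * Real.exp (-(1 / 2) * ‖u‖ ^ 2)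

lemma gaussDensity_nonneg (u : E) : 0 ≤ gaussDensity u :=
  mul_nonneg (inv_nonneg.2 gaussNorm_pos.le) (Real.exp_pos _).le

lemma continuous_gaussDensity : Continuous (gaussDensity : E → ℝ) := by
  unfold gaussDensity
  fun_prop

lemma integrable_gaussDensity : Integrable (gaussDensity : E → ℝ) :=
  integrable_exp_neg_half_sq_norm.const_mul _

/-- Both sides are finite measures with the same characteristic function, by the complex Gaussian
integral with linear term i⟨t, u⟩. This links the integral defining f_μ to the law of the random
directions. -/
lemma stdGaussian_eq_withDensity :
    stdGaussian E = volume.withDensity (fun u => ENNReal.ofReal (gaussDensity u)) := by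
  have hfin : IsFiniteMeasure
      ((volume : Measure E).withDensity (fun u => ENNReal.ofReal (gaussDensity u))) :=
    isFiniteMeasure_withDensity_ofReal integrable_gaussDensity.2
  apply Measure.ext_of_charFun
  ext t
  rw [charFun_stdGaussian, charFun_apply, integral_withDensity_eq_integral_toReal_smul
    (continuous_gaussDensity.measurable.ennreal_ofReal) (by simp)]
  have hb : 0 < (((1 / 2 : ℝ) : ℂ)).re := by simp
  have h := GaussianFourier.integral_cexp_neg_mul_sq_norm_add (V := E) hb Complex.I t
  have h0 : ((gaussNorm E : ℝ) : ℂ) =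
      (Real.pi / ((1 / 2 : ℝ) : ℂ)) ^ (Module.finrank ℝ E / 2 : ℂ) := by
    rw [gaussNorm, ← GaussianFourier.integral_cexp_neg_mul_sq_norm hb, ← integral_complex_ofReal]
    congr 1
    ext u
    push_cast
    rfl
  rw [← h0] at h
  have hκ : ((gaussNorm E : ℝ) : ℂ) ≠ 0 := by exact_mod_cast gaussNorm_pos.ne'
  calc Complex.exp (-(‖t‖ : ℂ) ^ 2 / 2)
      = ((gaussNorm E : ℝ) : ℂ)⁻¹ * ((gaussNorm E : ℝ) *
          Complex.exp (Complex.I ^ 2 * ‖t‖ ^ 2 / (4 * ((1 / 2 : ℝ) : ℂ)))) := by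
        rw [inv_mul_cancel_left₀ hκ]
        congr 1
        push_cast
        rw [Complex.I_sq]
        ring
    _ = _ := by
        rw [← h, ← integral_const_mul]
        congr 1
        ext u
        rw [ENNReal.toReal_ofReal (gaussDensity_nonneg u), gaussDensity, Complex.real_smul,
          Complex.exp_add, real_inner_comm]
        push_cast
        ring_nf

lemma integrable_stdGaussian_iff {F : Type*} [NormedAddCommGroup F] [NormedSpace ℝ F] {g : E → F} :
    Integrable g (stdGaussian E) ↔ Integrable (fun u => gaussDensity u • g u) := by
  rw [stdGaussian_eq_withDensity, integrable_withDensity_iff_integrable_smul'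
    (continuous_gaussDensity.measurable.ennreal_ofReal) (by simp)]
  simp_rw [ENNReal.toReal_ofReal (gaussDensity_nonneg _)]

lemma integral_stdGaussian {F : Type*} [NormedAddCommGroup F] [NormedSpace ℝ F] (g : E → F) :
    ∫ u, g u ∂(stdGaussian E) = ∫ u, gaussDensity u • g u := by
  rw [stdGaussian_eq_withDensity, integral_withDensity_eq_integral_toReal_smul
    (continuous_gaussDensity.measurable.ennreal_ofReal) (by simp)]
  simp_rw [ENNReal.toReal_ofReal (gaussDensity_nonneg _)]

/-- The Cameron–Martin formula. -/
lemma integral_add_stdGaussian (g : E → ℝ) (y : E) :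
    ∫ u, g (u + y) ∂(stdGaussian E) =
      ∫ u, Real.exp (⟪u, y⟫ - ‖y‖ ^ 2 / 2) * g u ∂(stdGaussian E) := by
  rw [integral_stdGaussian, integral_stdGaussian,
    ← integral_sub_right_eq_self (fun u => gaussDensity u • g (u + y)) y]
  congr 1
  ext u
  simp only [sub_add_cancel, smul_eq_mul, gaussDensity, ← mul_assoc]
  congr 1
  rw [mul_assoc, ← Real.exp_add, norm_sub_sq_real]
  congr 2
  ring

/-- Fernique's theorem makes some exp(C‖u‖²) integrable, and completing the square gives at ≤
a²/(4C) + Ct². Integrability of functions of exponential growth rests on this. -/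
lemma integrable_exp_mul_norm_stdGaussian (a : ℝ) :
    Integrable (fun u => Real.exp (a * ‖u‖)) (stdGaussian E) := by
  obtain ⟨C, hC, h⟩ := IsGaussian.exists_integrable_exp_sq (stdGaussian E)
  refine (h.const_mul (Real.exp (a ^ 2 / (4 * C)))).mono'
    (by fun_prop) (Eventually.of_forall fun u => ?_)
  rw [Real.norm_of_nonneg (Real.exp_pos _).le, ← Real.exp_add]
  apply Real.exp_le_exp.2
  have : a ^ 2 / (4 * C) + C * ‖u‖ ^ 2 - a * ‖u‖ = (a - 2 * C * ‖u‖) ^ 2 / (4 * C) := by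
    field_simp
    ring
  have : 0 ≤ (a - 2 * C * ‖u‖) ^ 2 / (4 * C) := by positivity
  linarith

/-! ### Moments -/

lemma integrable_norm_pow_stdGaussian (k : ℕ) :
    Integrable (fun u => ‖u‖ ^ k) (stdGaussian E) := by
  rcases eq_or_ne k 0 with rfl | hk
  · simp
  · exact (IsGaussian.memLp_id (stdGaussian E) k (by simp)).integrable_norm_pow hk

lemma cosh_ge_sum (x : ℝ) : 1 + x ^ 2 / 2 + x ^ 4 / 24 + x ^ 6 / 720 ≤ Real.cosh x := by
  have h := sum_le_hasSum (Finset.range 4) (fun i _ => by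
    rw [pow_mul]; positivity) (Real.hasSum_cosh x)
  simp only [Finset.sum_range_succ, Finset.sum_range_zero, Nat.factorial] at h
  norm_num at h
  linarith

lemma exp_half_le : Real.exp (1 / 2) ≤ 1.65 := by
  have h1 : Real.exp (1 / 2) ^ 2 = Real.exp 1 := by
    rw [← Real.exp_nat_mul]; norm_num
  have := Real.exp_one_lt_d9
  nlinarith [Real.exp_pos (1 / 2 : ℝ)]

lemma map_inner_stdGaussian {a : E} (ha : ‖a‖ = 1) :
    (stdGaussian E).map (fun u => ⟪a, u⟫) = gaussianReal 0 1 := by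
  have h := IsGaussian.map_eq_gaussianReal (μ := stdGaussian E) (innerSL ℝ a)
  rw [integral_strongDual_stdGaussian, variance_dual_stdGaussian, innerSL_apply_norm, ha] at h
  simpa using h

lemma integrable_inner_pow_stdGaussian (a : E) (k : ℕ) :
    Integrable (fun u => ⟪a, u⟫ ^ k) (stdGaussian E) := by
  refine ((integrable_norm_pow_stdGaussian k).const_mul (‖a‖ ^ k)).mono'
    (by fun_prop) (Eventually.of_forall fun u => ?_)
  rw [norm_pow, ← mul_pow]
  exact pow_le_pow_left₀ (norm_nonneg _) (norm_inner_le_norm _ _) _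

lemma integral_cosh_inner_stdGaussian {a : E} (ha : ‖a‖ = 1) :
    Integrable (fun u => Real.cosh ⟪a, u⟫) (stdGaussian E) ∧
      ∫ u, Real.cosh ⟪a, u⟫ ∂(stdGaussian E) = Real.exp (1 / 2) := by
  have hm := map_inner_stdGaussian ha
  have hmeas : AEMeasurable (fun u => ⟪a, u⟫) (stdGaussian E) := by fun_prop
  have hc : Real.cosh = fun x : ℝ => (Real.exp (1 * x) + Real.exp (-1 * x)) / 2 := by
    ext x; rw [Real.cosh_eq]; ring_nf
  have hi : Integrable Real.cosh (gaussianReal 0 1) := by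
    rw [hc]
    exact ((integrable_exp_mul_gaussianReal 1).add
      (integrable_exp_mul_gaussianReal (-1))).div_const _
  refine ⟨?_, ?_⟩
  · rw [← hm] at hi
    exact hi.comp_aemeasurable hmeas
  · rw [← integral_map (φ := fun u => ⟪a, u⟫) hmeas (f := Real.cosh)
      (Real.continuous_cosh.aestronglyMeasurable), hm, hc, integral_div,
      integral_add (integrable_exp_mul_gaussianReal 1) (integrable_exp_mul_gaussianReal (-1))]
    have h1 := congr_fun (mgf_fun_id_gaussianReal (μ := 0) (v := 1)) 1
    have h2 := congr_fun (mgf_fun_id_gaussianReal (μ := 0) (v := 1)) (-1)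
    simp only [mgf] at h1 h2
    rw [h1, h2]
    norm_num

lemma integral_inner_sq_stdGaussian (a : E) :
    ∫ u, ⟪a, u⟫ ^ 2 ∂(stdGaussian E) = ‖a‖ ^ 2 := by
  have h := variance_dual_stdGaussian (innerSL ℝ a)
  rw [variance_eq_integral (by fun_prop), integral_strongDual_stdGaussian, innerSL_apply_norm] at h
  simpa using h

/-- Integrating the truncated Taylor series of cosh against E cosh⟨a, u⟩ = √e ≤ 1.65 bounds both
moments at once: degrees 0 and 2 contribute exactly 3/2. Dropping either term leaves 24 · 0.15 ≤ 4
for the fourth moment and 720 · 0.15 = 108 for the sixth. -/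
lemma integral_inner_pow_aux {a : E} (ha : ‖a‖ = 1) :
    (∫ u, ⟪a, u⟫ ^ 4 ∂(stdGaussian E)) / 24 + (∫ u, ⟪a, u⟫ ^ 6 ∂(stdGaussian E)) / 720 ≤ 0.15 := by
  obtain ⟨hi, he⟩ := integral_cosh_inner_stdGaussian ha
  have h2 := (integrable_inner_pow_stdGaussian a 2).div_const 2
  have h4 := (integrable_inner_pow_stdGaussian a 4).div_const 24
  have h6 := (integrable_inner_pow_stdGaussian a 6).div_const 720
  have h1 : Integrable (fun _ : E => (1 : ℝ)) (stdGaussian E) := integrable_const _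
  have h := integral_mono (((h1.add h2).add h4).add h6) hi (fun u => cosh_ge_sum ⟪a, u⟫)
  rw [integral_add' ((h1.add h2).add h4) h6, integral_add' (h1.add h2) h4, integral_add' h1 h2,
    integral_div, integral_div, integral_div, integral_inner_sq_stdGaussian, ha, he] at h
  simp only [integral_const, probReal_univ, smul_eq_mul, one_pow, mul_one] at h
  have := exp_half_le
  linarith

lemma integral_inner_pow_eq (a : E) (k : ℕ) :
    ∫ u, ⟪a, u⟫ ^ k ∂(stdGaussian E) =
      ‖a‖ ^ k * ∫ u, ⟪(‖a‖⁻¹) • a, u⟫ ^ k ∂(stdGaussian E) := by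
  rcases eq_or_ne a 0 with rfl | ha
  · rcases eq_or_ne k 0 with rfl | hk <;> simp [*]
  · rw [← integral_const_mul]
    congr 1
    ext u
    rw [real_inner_smul_left, mul_pow, ← mul_assoc, ← mul_pow,
      mul_inv_cancel₀ (norm_ne_zero_iff.2 ha)]
    simp

lemma integral_inner_pow_four_le (a : E) :
    ∫ u, ⟪a, u⟫ ^ 4 ∂(stdGaussian E) ≤ 4 * ‖a‖ ^ 4 := by
  rcases eq_or_ne a 0 with rfl | ha
  · simp
  rw [integral_inner_pow_eq]
  have h := integral_inner_pow_aux (a := (‖a‖⁻¹) • a) (norm_smul_inv_norm ha)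
  have h6 : 0 ≤ ∫ u, ⟪(‖a‖⁻¹) • a, u⟫ ^ 6 ∂(stdGaussian E) :=
    integral_nonneg fun u => Even.pow_nonneg (by decide) _
  have h4 : ∫ u, ⟪(‖a‖⁻¹) • a, u⟫ ^ 4 ∂(stdGaussian E) ≤ 4 := by linarith
  rw [mul_comm 4]
  gcongr

lemma integral_inner_pow_six_le (a : E) :
    ∫ u, ⟪a, u⟫ ^ 6 ∂(stdGaussian E) ≤ 108 * ‖a‖ ^ 6 := by
  rcases eq_or_ne a 0 with rfl | ha
  · simp
  rw [integral_inner_pow_eq]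
  have h := integral_inner_pow_aux (a := (‖a‖⁻¹) • a) (norm_smul_inv_norm ha)
  have h6 : 0 ≤ ∫ u, ⟪(‖a‖⁻¹) • a, u⟫ ^ 4 ∂(stdGaussian E) :=
    integral_nonneg fun u => Even.pow_nonneg (by decide) _
  have h4 : ∫ u, ⟪(‖a‖⁻¹) • a, u⟫ ^ 6 ∂(stdGaussian E) ≤ 108 := by linarith
  rw [mul_comm 108]
  gcongr

variable (E) in
lemma integral_norm_sq_stdGaussian :
    ∫ u, ‖u‖ ^ 2 ∂(stdGaussian E) = Module.finrank ℝ E := by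
  simp_rw [← (stdOrthonormalBasis ℝ E).sum_sq_inner_right]
  rw [integral_finsetSum _ fun i _ => integrable_inner_pow_stdGaussian _ 2]
  simp [integral_inner_sq_stdGaussian]

/-- The power mean inequality over the n squared coordinates; it reduces moments of ‖u‖ to
one-dimensional ones without using independence of coordinates. -/
lemma norm_pow_le_sum_inner_pow (u : E) (k : ℕ) :
    ‖u‖ ^ (2 * (k + 1)) ≤ (Module.finrank ℝ E : ℝ) ^ k *
      ∑ i, ⟪stdOrthonormalBasis ℝ E i, u⟫ ^ (2 * (k + 1)) := by
  rw [pow_mul, ← (stdOrthonormalBasis ℝ E).sum_sq_inner_right]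
  simp_rw [pow_mul _ 2]
  have h := pow_sum_le_card_mul_sum_pow (s := Finset.univ)
    (f := fun i => ⟪stdOrthonormalBasis ℝ E i, u⟫ ^ 2) (fun i _ => sq_nonneg _) k
  simpa using h

variable (E) in
lemma integral_norm_pow_four_le :
    ∫ u, ‖u‖ ^ 4 ∂(stdGaussian E) ≤ 4 * (Module.finrank ℝ E : ℝ) ^ 2 := by
  have h : ∀ u : E, ‖u‖ ^ 4 ≤ (Module.finrank ℝ E : ℝ) ^ 1 *
      ∑ i, ⟪stdOrthonormalBasis ℝ E i, u⟫ ^ 4 := fun u => norm_pow_le_sum_inner_pow u 1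
  have hi := fun i => integrable_inner_pow_stdGaussian (stdOrthonormalBasis ℝ E i) 4
  refine (integral_mono (integrable_norm_pow_stdGaussian 4)
    ((integrable_finsetSum _ fun i _ => hi i).const_mul _) h).trans ?_
  rw [integral_const_mul, integral_finsetSum _ fun i _ => hi i]
  have : ∑ i, ∫ u, ⟪stdOrthonormalBasis ℝ E i, u⟫ ^ 4 ∂(stdGaussian E) ≤
      ∑ _i : Fin (Module.finrank ℝ E), (4 : ℝ) :=
    Finset.sum_le_sum fun i _ => (integral_inner_pow_four_le _).trans (by simp)
  simp only [Finset.sum_const, Finset.card_univ, Fintype.card_fin, nsmul_eq_mul] at this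
  calc _ ≤ (Module.finrank ℝ E : ℝ) ^ 1 * (Module.finrank ℝ E * 4) := by gcongr
    _ = _ := by ring

variable (E) in
lemma integral_norm_pow_six_le :
    ∫ u, ‖u‖ ^ 6 ∂(stdGaussian E) ≤ 108 * (Module.finrank ℝ E : ℝ) ^ 3 := by
  have h : ∀ u : E, ‖u‖ ^ 6 ≤ (Module.finrank ℝ E : ℝ) ^ 2 *
      ∑ i, ⟪stdOrthonormalBasis ℝ E i, u⟫ ^ 6 := fun u => norm_pow_le_sum_inner_pow u 2
  have hi := fun i => integrable_inner_pow_stdGaussian (stdOrthonormalBasis ℝ E i) 6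
  refine (integral_mono (integrable_norm_pow_stdGaussian 6)
    ((integrable_finsetSum _ fun i _ => hi i).const_mul _) h).trans ?_
  rw [integral_const_mul, integral_finsetSum _ fun i _ => hi i]
  have : ∑ i, ∫ u, ⟪stdOrthonormalBasis ℝ E i, u⟫ ^ 6 ∂(stdGaussian E) ≤
      ∑ _i : Fin (Module.finrank ℝ E), (108 : ℝ) :=
    Finset.sum_le_sum fun i _ => (integral_inner_pow_six_le _).trans (by simp)
  simp only [Finset.sum_const, Finset.card_univ, Fintype.card_fin, nsmul_eq_mul] at this
  calc _ ≤ (Module.finrank ℝ E : ℝ) ^ 2 * (Module.finrank ℝ E * 108) := by gcongr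
    _ = _ := by ring

lemma integrable_inner_sq_mul_norm_sq (a : E) :
    Integrable (fun u => ⟪a, u⟫ ^ 2 * ‖u‖ ^ 2) (stdGaussian E) := by
  refine ((integrable_norm_pow_stdGaussian 4).const_mul (‖a‖ ^ 2)).mono'
    (by fun_prop) (Eventually.of_forall fun u => ?_)
  rw [Real.norm_of_nonneg (by positivity), ← sq_abs ⟪a, u⟫]
  calc |⟪a, u⟫| ^ 2 * ‖u‖ ^ 2 ≤ (‖a‖ * ‖u‖) ^ 2 * ‖u‖ ^ 2 := by
        gcongr; exact abs_real_inner_le_norm a u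
    _ = _ := by ring

/-- Expand ‖u‖² in an orthonormal basis and apply AM-GM to each ⟨a, u⟩²⟨bᵢ, u⟩², weighted so that
both fourth moments scale like ‖a‖². Growth only linear in n is what lets a step size of order 1/n
absorb this term. -/
lemma integral_inner_sq_mul_norm_sq_le (a : E) :
    ∫ u, ⟪a, u⟫ ^ 2 * ‖u‖ ^ 2 ∂(stdGaussian E) ≤ 4 * Module.finrank ℝ E * ‖a‖ ^ 2 := by
  rcases eq_or_ne a 0 with rfl | ha
  · simp
  have ha' : 0 < ‖a‖ := norm_pos_iff.2 ha
  set b := stdOrthonormalBasis ℝ E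
  have h : ∀ u : E, ⟪a, u⟫ ^ 2 * ‖u‖ ^ 2 ≤
      ∑ i, ((‖a‖ ^ 2)⁻¹ / 2 * ⟪a, u⟫ ^ 4 + ‖a‖ ^ 2 / 2 * ⟪b i, u⟫ ^ 4) := by
    intro u
    rw [← b.sum_sq_inner_right u, Finset.mul_sum]
    refine Finset.sum_le_sum fun i _ => ?_
    have := sq_nonneg (‖a‖⁻¹ * ⟪a, u⟫ ^ 2 - ‖a‖ * ⟪b i, u⟫ ^ 2)
    have e : (‖a‖⁻¹ * ⟪a, u⟫ ^ 2 - ‖a‖ * ⟪b i, u⟫ ^ 2) ^ 2 =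
      (‖a‖ ^ 2)⁻¹ * ⟪a, u⟫ ^ 4 + ‖a‖ ^ 2 * ⟪b i, u⟫ ^ 4 - 2 * (⟪a, u⟫ ^ 2 * ⟪b i, u⟫ ^ 2) := by
      field_simp
      ring
    rw [e] at this
    linarith
  have hi1 := (integrable_inner_pow_stdGaussian a 4).const_mul ((‖a‖ ^ 2)⁻¹ / 2)
  have hi2 := fun i => (integrable_inner_pow_stdGaussian (b i) 4).const_mul (‖a‖ ^ 2 / 2)
  refine (integral_mono (integrable_inner_sq_mul_norm_sq a)
    (integrable_finsetSum _ fun i _ => hi1.add (hi2 i)) h).trans ?_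
  rw [integral_finsetSum _ fun i _ => hi1.add (hi2 i)]
  have : ∀ i, ∫ u, ((‖a‖ ^ 2)⁻¹ / 2 * ⟪a, u⟫ ^ 4 + ‖a‖ ^ 2 / 2 * ⟪b i, u⟫ ^ 4) ∂(stdGaussian E) ≤
      4 * ‖a‖ ^ 2 := by
    intro i
    rw [integral_add hi1 (hi2 i), integral_const_mul, integral_const_mul]
    have h1 := integral_inner_pow_four_le a
    have h2 := integral_inner_pow_four_le (b i)
    rw [b.norm_eq_one] at h2
    calc _ ≤ (‖a‖ ^ 2)⁻¹ / 2 * (4 * ‖a‖ ^ 4) + ‖a‖ ^ 2 / 2 * (4 * 1 ^ 4) := by gcongr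
      _ = _ := by field_simp; ring
  refine (Finset.sum_le_sum fun i _ => this i).trans ?_
  simp only [Finset.sum_const, Finset.card_univ, Fintype.card_fin, nsmul_eq_mul]
  linarith

lemma integrable_norm_rpow_stdGaussian {p : ℝ} (hp : 0 ≤ p) :
    Integrable (fun u => ‖u‖ ^ p) (stdGaussian E) := by
  refine (integrable_exp_mul_norm_stdGaussian p).mono' (by fun_prop)
    (Eventually.of_forall fun u => ?_)
  rw [Real.norm_of_nonneg (by positivity), mul_comm, Real.exp_mul]
  exact Real.rpow_le_rpow (norm_nonneg _)
    ((le_add_of_nonneg_right zero_le_one).trans (Real.add_one_le_exp _)) hp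

/-- Young's inequality in the form used to bound the moments of `‖u‖` of fractional order. -/
lemma rpow_two_mul_le {n t θ : ℝ} (hn : 0 < n) (ht : 0 ≤ t) (h0 : 0 ≤ θ) (h1 : θ ≤ 1) :
    t ^ (2 * θ) ≤ n ^ θ * ((1 - θ) + θ * (t ^ 2 / n)) := by
  have h := Real.geom_mean_le_arith_mean2_weighted (sub_nonneg.2 h1) h0 zero_le_one
    (show 0 ≤ t ^ 2 / n by positivity) (by ring)
  rw [Real.one_rpow, one_mul, mul_one] at h
  calc t ^ (2 * θ) = n ^ θ * (t ^ 2 / n) ^ θ := by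
        rw [← Real.mul_rpow hn.le (by positivity), mul_div_cancel₀ _ hn.ne', Real.rpow_mul ht]
        norm_num
    _ ≤ _ := by gcongr

/-- In the integrated Young inequality the bracket becomes (1 - θ) + θ · E‖u‖²/n = 1, so the
constant is exactly one. -/
lemma integral_norm_rpow_le {θ : ℝ} (h0 : 0 ≤ θ) (h1 : θ ≤ 1) (hn : 0 < Module.finrank ℝ E) :
    ∫ u, ‖u‖ ^ (2 * θ) ∂(stdGaussian E) ≤ (Module.finrank ℝ E : ℝ) ^ θ := by
  have hn' : (0 : ℝ) < Module.finrank ℝ E := by exact_mod_cast hn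
  have hi : Integrable (fun u : E => θ * (‖u‖ ^ 2 / Module.finrank ℝ E)) (stdGaussian E) :=
    ((integrable_norm_pow_stdGaussian 2).div_const _).const_mul _
  refine (integral_mono (integrable_norm_rpow_stdGaussian (by positivity))
    (((integrable_const _).add hi).const_mul _)
    fun u => rpow_two_mul_le hn' (norm_nonneg u) h0 h1).trans_eq ?_
  rw [integral_const_mul, integral_add' (integrable_const _) hi, integral_const_mul, integral_div,
    integral_norm_sq_stdGaussian]
  simp [hn'.ne']

lemma integral_norm_pow_four_mul_rpow_le {θ : ℝ} (h0 : 0 ≤ θ) (h1 : θ ≤ 1)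
    (hn : 0 < Module.finrank ℝ E) :
    Integrable (fun u => ‖u‖ ^ 4 * ‖u‖ ^ (2 * θ)) (stdGaussian E) ∧
    ∫ u, ‖u‖ ^ 4 * ‖u‖ ^ (2 * θ) ∂(stdGaussian E) ≤
      108 * (Module.finrank ℝ E : ℝ) ^ 2 * (Module.finrank ℝ E : ℝ) ^ θ := by
  have hn' : (0 : ℝ) < Module.finrank ℝ E := by exact_mod_cast hn
  set n : ℝ := (Module.finrank ℝ E : ℝ)
  have h4 := (integrable_norm_pow_stdGaussian (E := E) 4).const_mul (1 - θ)
  have h6 := (integrable_norm_pow_stdGaussian (E := E) 6).const_mul (θ / n)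
  have hle : ∀ u : E, ‖u‖ ^ 4 * ‖u‖ ^ (2 * θ) ≤
      n ^ θ * ((1 - θ) * ‖u‖ ^ 4 + θ / n * ‖u‖ ^ 6) := fun u =>
    calc _ ≤ ‖u‖ ^ 4 * (n ^ θ * ((1 - θ) + θ * (‖u‖ ^ 2 / n))) := by
          gcongr; exact rpow_two_mul_le hn' (norm_nonneg u) h0 h1
      _ = _ := by ring
  have hi : Integrable (fun u => ‖u‖ ^ 4 * ‖u‖ ^ (2 * θ)) (stdGaussian E) := by
    refine ((h4.add h6).const_mul (n ^ θ)).mono' (by fun_prop) (Eventually.of_forall fun u => ?_)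
    rw [Real.norm_of_nonneg (by positivity)]
    exact hle u
  refine ⟨hi, (integral_mono hi ((h4.add h6).const_mul (n ^ θ)) hle).trans ?_⟩
  rw [integral_const_mul, integral_add' h4 h6, integral_const_mul, integral_const_mul]
  have e4 := integral_norm_pow_four_le E
  have e6 := integral_norm_pow_six_le E
  have h1' : 0 ≤ 1 - θ := sub_nonneg.2 h1
  calc _ ≤ n ^ θ * ((1 - θ) * (4 * n ^ 2) + θ / n * (108 * n ^ 3)) := by gcongr
    _ = n ^ θ * n ^ 2 * ((1 - θ) * 4 + θ * 108) := by field_simp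
    _ ≤ n ^ θ * n ^ 2 * 108 := by gcongr; linarith
    _ = _ := by ring

end Gaussian

/-! ### Hölder gradients and the regularity of Gaussian averages -/

section Smoothing

variable {E : Type*} [NormedAddCommGroup E] [InnerProductSpace ℝ E] [FiniteDimensional ℝ E]
  [MeasurableSpace E] [BorelSpace E]

/-! ### Functions of at most exponential growth -/

/-- `F` grows at most exponentially. -/
def ExpGrowth {G : Type*} [NormedAddCommGroup G] (F : E → G) : Prop :=
  ∃ C a : ℝ, 0 ≤ C ∧ 0 ≤ a ∧ ∀ z, ‖F z‖ ≤ C * Real.exp (a * ‖z‖)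

namespace ExpGrowth

variable {G H : Type*} [NormedAddCommGroup G] [NormedAddCommGroup H]

lemma integrable {F : E → G} (hF : ExpGrowth F) (hm : AEStronglyMeasurable F (stdGaussian E)) :
    Integrable F (stdGaussian E) := by
  obtain ⟨C, a, -, -, h⟩ := hF
  exact ((integrable_exp_mul_norm_stdGaussian a).const_mul C).mono' hm (Eventually.of_forall h)

lemma mono {F : E → G} {F' : E → H} (hF : ExpGrowth F) (h : ∀ z, ‖F' z‖ ≤ ‖F z‖) :
    ExpGrowth F' := by
  obtain ⟨C, a, hC, ha, h'⟩ := hF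
  exact ⟨C, a, hC, ha, fun z => (h z).trans (h' z)⟩

lemma const (c : G) : ExpGrowth (fun _ : E => c) :=
  ⟨‖c‖, 0, norm_nonneg _, le_rfl, fun z => by simp⟩

lemma norm_id : ExpGrowth (fun z : E => ‖z‖) :=
  ⟨1, 1, zero_le_one, zero_le_one, fun z => by
    rw [norm_norm, one_mul, one_mul]
    exact (le_add_of_nonneg_right zero_le_one).trans (Real.add_one_le_exp _)⟩

lemma exp_norm : ExpGrowth (fun z : E => Real.exp ‖z‖) :=
  ⟨1, 1, zero_le_one, zero_le_one, fun z => by simp⟩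

lemma mul {F F' : E → ℝ} (hF : ExpGrowth F) (hF' : ExpGrowth F') :
    ExpGrowth (fun z => F z * F' z) := by
  obtain ⟨C, a, hC, ha, h⟩ := hF
  obtain ⟨C', a', hC', ha', h'⟩ := hF'
  refine ⟨C * C', a + a', by positivity, by positivity, fun z => ?_⟩
  rw [norm_mul, add_mul, Real.exp_add]
  calc _ ≤ (C * Real.exp (a * ‖z‖)) * (C' * Real.exp (a' * ‖z‖)) := by
        gcongr
        exacts [h z, h' z]
    _ = _ := by ring

lemma add {F F' : E → G} (hF : ExpGrowth F) (hF' : ExpGrowth F') :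
    ExpGrowth (fun z => F z + F' z) := by
  obtain ⟨C, a, hC, ha, h⟩ := hF
  obtain ⟨C', a', hC', ha', h'⟩ := hF'
  refine ⟨C + C', a + a', by positivity, by positivity, fun z => ?_⟩
  rw [add_mul]
  refine (norm_add_le _ _).trans (add_le_add ((h z).trans ?_) ((h' z).trans ?_))
  · gcongr; linarith
  · gcongr; linarith

lemma neg {F : E → G} (hF : ExpGrowth F) : ExpGrowth (fun z => -F z) :=
  hF.mono fun _ => (norm_neg _).le

lemma sub {F F' : E → G} (hF : ExpGrowth F) (hF' : ExpGrowth F') :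
    ExpGrowth (fun z => F z - F' z) := by
  simpa only [sub_eq_add_neg] using hF.add hF'.neg

lemma norm {F : E → G} (hF : ExpGrowth F) : ExpGrowth (fun z => ‖F z‖) :=
  hF.mono fun _ => (norm_norm _).le

lemma comp_affine {F : E → G} (hF : ExpGrowth F) (x : E) (μ : ℝ) :
    ExpGrowth (fun u => F (x + μ • u)) := by
  obtain ⟨C, a, hC, ha, h⟩ := hF
  refine ⟨C * Real.exp (a * ‖x‖), a * |μ|, by positivity, by positivity, fun u => (h _).trans ?_⟩
  rw [mul_assoc, ← Real.exp_add]
  gcongr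
  calc a * ‖x + μ • u‖ ≤ a * (‖x‖ + ‖μ • u‖) := by gcongr; exact norm_add_le _ _
    _ = _ := by rw [norm_smul, Real.norm_eq_abs]; ring

lemma inner_left (a : E) : ExpGrowth (fun u : E => ⟪a, u⟫) :=
  ((const ‖a‖).mul norm_id).mono fun z => by
    rw [Real.norm_of_nonneg (by positivity : (0 : ℝ) ≤ ‖a‖ * ‖z‖)]
    exact norm_inner_le_norm a z

end ExpGrowth

/-! ### Functions with Hölder continuous gradient -/

lemma rpow_le_exp_two_mul {t p : ℝ} (ht : 0 ≤ t) (h0 : 0 ≤ p) (h2 : p ≤ 2) :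
    t ^ p ≤ Real.exp (2 * t) := by
  calc t ^ p ≤ (Real.exp t) ^ p := by
        gcongr; linarith [Real.add_one_le_exp t]
    _ = Real.exp (t * p) := (Real.exp_mul _ _).symm
    _ ≤ _ := Real.exp_le_exp.2 (by nlinarith)

namespace HasHolderGradient

variable {f : E → ℝ} {ν L : ℝ}

/-- Along the segment the remainder has derivative at most L‖d‖^(1+ν) t^ν, and comparison with the
primitive of this bound gives the claim. No integral of ∇f is taken, so ∇f need not be continuous,
which matters for ν = 0. The case ν = 1, applied to f_μ, is the descent inequality. -/
lemma abs_sub_sub_le (hf : HasHolderGradient f ν L) (h0 : 0 ≤ ν) (x y : E) :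
    |f y - f x - fderiv ℝ f x (y - x)| ≤ L / (1 + ν) * ‖y - x‖ ^ (1 + ν) := by
  set d := y - x with hd
  have hν : (1 + ν) ≠ 0 := by positivity
  have hφ : ∀ t : ℝ, HasDerivAt (fun t : ℝ => f (x + t • d) - f x - t * fderiv ℝ f x d)
      ((fderiv ℝ f (x + t • d) - fderiv ℝ f x) d) t := by
    intro t
    have h1 : HasDerivAt (fun t : ℝ => x + t • d) d t := by
      simpa using ((hasDerivAt_id t).smul_const d).const_add x
    have h2 := ((hf.1 (x + t • d)).hasFDerivAt.comp_hasDerivAt t h1).sub_const (f x)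
    exact (h2.sub ((hasDerivAt_id t).mul_const (fderiv ℝ f x d))).congr_deriv (by simp)
  have hB : ∀ t : ℝ, HasDerivAt (fun t : ℝ => L / (1 + ν) * ‖d‖ ^ (1 + ν) * t ^ (1 + ν))
      (L * ‖d‖ ^ (1 + ν) * t ^ ν) t := by
    intro t
    refine ((Real.hasDerivAt_rpow_const (x := t) (p := 1 + ν) (Or.inr (by linarith))).const_mul
      (L / (1 + ν) * ‖d‖ ^ (1 + ν))).congr_deriv ?_
    rw [add_sub_cancel_left]
    field_simp
  have h := image_norm_le_of_norm_deriv_right_le_deriv_boundary (a := 0) (b := 1)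
    (fun t _ => (hφ t).continuousAt.continuousWithinAt)
    (fun t _ => (hφ t).hasDerivWithinAt) (by simp [hν]) hB
    (fun t ht => ?_) (Set.right_mem_Icc.2 zero_le_one)
  · simpa [hd] using h
  · refine (ContinuousLinearMap.le_opNorm _ _).trans ?_
    have := hf.2 x (x + t • d)
    rw [add_sub_cancel_left, norm_smul, Real.norm_of_nonneg ht.1,
      Real.mul_rpow ht.1 (norm_nonneg _)] at this
    calc _ ≤ L * (t ^ ν * ‖d‖ ^ ν) * ‖d‖ := by gcongr
      _ = L * (‖d‖ ^ ν * ‖d‖) * t ^ ν := by ring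
      _ = _ := by
        rw [add_comm 1 ν, Real.rpow_add_one' (norm_nonneg _) (by positivity)]

lemma expGrowth_fderiv (hf : HasHolderGradient f ν L) (h0 : 0 ≤ ν) (h1 : ν ≤ 1) (hL : 0 ≤ L) :
    ExpGrowth (fderiv ℝ f) := by
  refine ⟨‖fderiv ℝ f 0‖ + L, 2, by positivity, by norm_num, fun z => ?_⟩
  have h := hf.2 0 z
  rw [sub_zero] at h
  have h2 := rpow_le_exp_two_mul (norm_nonneg z) h0 (by linarith : ν ≤ 2)
  have h3 : 1 ≤ Real.exp (2 * ‖z‖) := Real.one_le_exp (by positivity)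
  calc ‖fderiv ℝ f z‖ = ‖fderiv ℝ f 0 + (fderiv ℝ f z - fderiv ℝ f 0)‖ := by abel_nf
    _ ≤ ‖fderiv ℝ f 0‖ * 1 + L * ‖z‖ ^ ν := (norm_add_le _ _).trans (by linarith)
    _ ≤ ‖fderiv ℝ f 0‖ * Real.exp (2 * ‖z‖) + L * Real.exp (2 * ‖z‖) := by gcongr
    _ = _ := by ring

lemma expGrowth (hf : HasHolderGradient f ν L) (h0 : 0 ≤ ν) (h1 : ν ≤ 1) (hL : 0 ≤ L) :
    ExpGrowth f := by
  refine ⟨|f 0| + ‖fderiv ℝ f 0‖ + L / (1 + ν), 2, by positivity, by norm_num, fun z => ?_⟩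
  have h := hf.abs_sub_sub_le h0 0 z
  rw [sub_zero] at h
  have h2 := rpow_le_exp_two_mul (norm_nonneg z) (by positivity : 0 ≤ 1 + ν) (by linarith)
  have h3 : 1 ≤ Real.exp (2 * ‖z‖) := Real.one_le_exp (by positivity)
  have h4 := rpow_le_exp_two_mul (norm_nonneg z) zero_le_one one_le_two
  rw [Real.rpow_one] at h4
  have h5 := (fderiv ℝ f 0).le_opNorm z
  calc ‖f z‖ = ‖f 0 + fderiv ℝ f 0 z + (f z - f 0 - fderiv ℝ f 0 z)‖ := by congr 1; ring
    _ ≤ ‖f 0‖ + ‖fderiv ℝ f 0 z‖ + ‖f z - f 0 - fderiv ℝ f 0 z‖ := norm_add₃_le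
    _ ≤ |f 0| * 1 + ‖fderiv ℝ f 0‖ * ‖z‖ + L / (1 + ν) * ‖z‖ ^ (1 + ν) := by
        rw [mul_one]; exact add_le_add (add_le_add le_rfl h5) h
    _ ≤ |f 0| * Real.exp (2 * ‖z‖) + ‖fderiv ℝ f 0‖ * Real.exp (2 * ‖z‖) +
        L / (1 + ν) * Real.exp (2 * ‖z‖) := by gcongr
    _ = _ := by ring

end HasHolderGradient

/-! ### Gaussian averages -/

lemma smoothed_eq_integral (f : E → ℝ) (μ : ℝ) (x : E) :
    smoothed f μ x = ∫ u, f (x + μ • u) ∂(stdGaussian E) := by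
  rw [smoothed, integral_stdGaussian, ← integral_const_mul]
  congr 1
  ext u
  rw [gaussDensity, smul_eq_mul]
  ring

lemma integrable_mul_exp_of_integrable_stdGaussian {g : E → ℝ}
    (hg : Integrable g (stdGaussian E)) :
    Integrable (fun w : E => g w * Real.exp (-(1 / 2) * ‖w‖ ^ 2)) := by
  rw [integrable_stdGaussian_iff] at hg
  refine (hg.const_mul (gaussNorm E)).congr (Eventually.of_forall fun w => ?_)
  simp only [gaussDensity, smul_eq_mul]
  field_simp [(gaussNorm_pos (E := E)).ne']

lemma integrable_comp_affine {G : Type*} [NormedAddCommGroup G]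
    [MeasurableSpace G] [BorelSpace G] [SecondCountableTopology G]
    {F : E → G} (hF : ExpGrowth F) (hm : Measurable F) (x : E) (μ : ℝ) :
    Integrable (fun u => F (x + μ • u)) (stdGaussian E) :=
  (hF.comp_affine x μ).integrable (hm.comp (by fun_prop)).aestronglyMeasurable

/-- Differentiation under the Gaussian integral, with the derivative falling on the integrand. -/
lemma hasFDerivAt_integral_comp_affine {f : E → ℝ} (hd : Differentiable ℝ f) (hf : ExpGrowth f)
    (hf' : ExpGrowth (fderiv ℝ f)) (x : E) (μ : ℝ) :
    HasFDerivAt (fun x => ∫ u, f (x + μ • u) ∂(stdGaussian E))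
      (∫ u, fderiv ℝ f (x + μ • u) ∂(stdGaussian E)) x := by
  obtain ⟨C, a, hC, ha, hb⟩ := hf'
  refine hasFDerivAt_integral_of_dominated_of_fderiv_le (s := Metric.ball x 1)
    (F := fun x u => f (x + μ • u)) (F' := fun x u => fderiv ℝ f (x + μ • u))
    (bound := fun u => C * Real.exp (a * (‖x‖ + 1)) * Real.exp (a * |μ| * ‖u‖))
    (Metric.ball_mem_nhds x one_pos) ?_ ?_ ?_ ?_ ?_ ?_
  · exact Eventually.of_forall fun y =>
      (hd.continuous.comp (by fun_prop)).aestronglyMeasurable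
  · exact integrable_comp_affine hf hd.continuous.measurable x μ
  · exact ((measurable_fderiv ℝ f).comp (by fun_prop)).aestronglyMeasurable
  · refine Eventually.of_forall fun u y hy => (hb _).trans ?_
    rw [mul_assoc, ← Real.exp_add]
    have h1 : ‖y‖ ≤ ‖x‖ + 1 := by
      have := norm_le_norm_add_norm_sub' y x
      rw [mem_ball_iff_norm] at hy
      linarith
    gcongr
    calc a * ‖y + μ • u‖ ≤ a * (‖y‖ + ‖μ • u‖) := by gcongr; exact norm_add_le _ _
      _ ≤ a * ((‖x‖ + 1) + |μ| * ‖u‖) := by rw [norm_smul, Real.norm_eq_abs]; gcongr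
      _ = _ := by ring
  · exact (integrable_exp_mul_norm_stdGaussian _).const_mul _
  · refine Eventually.of_forall fun u y _ => ?_
    have h1 : HasFDerivAt (fun y : E => y + μ • u) (ContinuousLinearMap.id ℝ E) y :=
      (hasFDerivAt_id y).add_const _
    exact (hd (y + μ • u)).hasFDerivAt.comp y h1

/-- In the Cameron–Martin formula the translation y enters only through a smooth weight, so `g` need
only be measurable. At y = 0 the weight is 1 with derivative ⟨u, ·⟩; on the unit ball its derivative
is dominated by e^‖u‖(‖u‖ + 1). -/
lemma hasFDerivAt_integral_exp_inner {g : E → ℝ} (hg : ExpGrowth g) (hm : Measurable g) :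
    HasFDerivAt (fun y => ∫ u, Real.exp (⟪u, y⟫ - ‖y‖ ^ 2 / 2) * g u ∂(stdGaussian E))
      (∫ u, g u • innerSL ℝ u ∂(stdGaussian E)) 0 := by
  have h := hasFDerivAt_integral_of_dominated_of_fderiv_le (μ := stdGaussian E) (x₀ := (0 : E))
    (s := Metric.ball (0 : E) 1)
    (F := fun y u => Real.exp (⟪u, y⟫ - ‖y‖ ^ 2 / 2) * g u)
    (F' := fun y u => (Real.exp (⟪u, y⟫ - ‖y‖ ^ 2 / 2) * g u) • (innerSL ℝ u - innerSL ℝ y))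
    (bound := fun u => (Real.exp ‖u‖ * ‖g u‖) * (‖u‖ + 1))
    (Metric.ball_mem_nhds 0 one_pos) ?_ ?_ ?_ ?_ ?_ ?_
  · simpa using h
  · exact Eventually.of_forall fun y => by fun_prop
  · simpa using hg.integrable hm.aestronglyMeasurable
  · simp only [inner_zero_right, norm_zero, map_zero, sub_zero]
    exact ((measurable_const.mul hm).smul
      (innerSL ℝ (E := E)).continuous.measurable).aestronglyMeasurable
  · refine Eventually.of_forall fun u y hy => ?_
    rw [mem_ball_zero_iff] at hy
    rw [norm_smul, norm_mul, Real.norm_of_nonneg (Real.exp_pos _).le]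
    have h1 : ⟪u, y⟫ ≤ ‖u‖ := by
      refine (real_inner_le_norm u y).trans ?_
      nlinarith [norm_nonneg u]
    have h2 : ‖innerSL ℝ u - innerSL ℝ y‖ ≤ ‖u‖ + 1 := by
      refine (norm_sub_le _ _).trans ?_
      rw [innerSL_apply_norm, innerSL_apply_norm]
      linarith
    gcongr
    linarith [sq_nonneg ‖y‖]
  · refine ((ExpGrowth.exp_norm.mul hg.norm).mul
      (ExpGrowth.norm_id.add (ExpGrowth.const 1))).integrable ?_
    fun_prop
  · refine Eventually.of_forall fun u y _ => ?_
    have h1 : HasFDerivAt (fun y : E => ⟪u, y⟫ - ‖y‖ ^ 2 / 2) (innerSL ℝ u - innerSL ℝ y) y := by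
      have h2 : HasFDerivAt (fun y : E => ‖y‖ ^ 2 / 2) (innerSL ℝ y) y := by
        simp_rw [div_eq_mul_inv]
        refine (((hasStrictFDerivAt_norm_sq y).hasFDerivAt).mul_const (2⁻¹ : ℝ)).congr_fderiv ?_
        ext w
        simp
      exact (innerSL ℝ u).hasFDerivAt.sub h2
    refine ((h1.exp).mul_const (g u)).congr_fderiv ?_
    rw [smul_smul, mul_comm]

/-- Differentiation of a Gaussian average, with the derivative falling on the density; `F` need not
be continuous. -/
lemma hasFDerivAt_integral_comp_affine' {F : E → ℝ} (hF : ExpGrowth F) (hm : Measurable F) (x : E)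
    {μ : ℝ} (hμ : μ ≠ 0) :
    HasFDerivAt (fun x => ∫ u, F (x + μ • u) ∂(stdGaussian E))
      (μ⁻¹ • ∫ u, F (x + μ • u) • innerSL ℝ u ∂(stdGaussian E)) x := by
  have hg := hF.comp_affine x μ
  have hgm : Measurable (fun u => F (x + μ • u)) := hm.comp (by fun_prop)
  -- Substituting z = x + μy turns the average at z into a Gaussian integral translated by y, to be
  -- differentiated at y = 0.
  have h1 : HasFDerivAt (fun z : E => μ⁻¹ • (z - x)) (μ⁻¹ • ContinuousLinearMap.id ℝ E) x :=
    ((hasFDerivAt_id x).sub_const x).const_smul _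
  have h2 : HasFDerivAt
      (fun y => ∫ u, Real.exp (⟪u, y⟫ - ‖y‖ ^ 2 / 2) * F (x + μ • u) ∂(stdGaussian E))
      (∫ u, F (x + μ • u) • innerSL ℝ u ∂(stdGaussian E)) (μ⁻¹ • (x - x)) := by
    rw [sub_self, smul_zero]
    exact hasFDerivAt_integral_exp_inner hg hgm
  have h3 := h2.comp x h1
  rw [ContinuousLinearMap.comp_smul, ContinuousLinearMap.comp_id] at h3
  refine h3.congr_of_eventuallyEq (Eventually.of_forall fun z => ?_)
  simp only [Function.comp]
  rw [← integral_add_stdGaussian (fun u => F (x + μ • u))]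
  congr 1
  ext u
  rw [smul_add, smul_inv_smul₀ hμ]
  congr 1
  abel

lemma integrable_smul_innerSL {g : E → ℝ} (hg : ExpGrowth g) (hm : Measurable g) :
    Integrable (fun u => g u • innerSL ℝ u) (stdGaussian E) := by
  refine ((hg.mul ExpGrowth.norm_id).mono fun u => ?_).integrable
    (hm.smul (innerSL ℝ (E := E)).continuous.measurable).aestronglyMeasurable
  rw [norm_smul, innerSL_apply_norm, norm_mul, norm_norm]

lemma integral_inner_stdGaussian (a : E) : ∫ u, ⟪u, a⟫ ∂(stdGaussian E) = 0 := by
  simp_rw [real_inner_comm a]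
  exact integral_strongDual_stdGaussian (innerSL ℝ a)

/-! ### The smoothed function -/

namespace HasHolderGradient

variable {f : E → ℝ} {ν L μ : ℝ}

lemma measurable (hf : HasHolderGradient f ν L) : Measurable f := hf.1.continuous.measurable

lemma hasFDerivAt_smoothed (hf : HasHolderGradient f ν L) (h0 : 0 ≤ ν) (h1 : ν ≤ 1) (hL : 0 ≤ L)
    (μ : ℝ) (x : E) :
    HasFDerivAt (smoothed f μ) (∫ u, fderiv ℝ f (x + μ • u) ∂(stdGaussian E)) x := by
  rw [show smoothed f μ = _ from funext (smoothed_eq_integral f μ)]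
  exact hasFDerivAt_integral_comp_affine hf.1 (hf.expGrowth h0 h1 hL) (hf.expGrowth_fderiv h0 h1 hL)
    x μ

lemma fderiv_smoothed_apply (hf : HasHolderGradient f ν L) (h0 : 0 ≤ ν) (h1 : ν ≤ 1) (hL : 0 ≤ L)
    (μ : ℝ) (x w : E) :
    fderiv ℝ (smoothed f μ) x w = ∫ u, fderiv ℝ f (x + μ • u) w ∂(stdGaussian E) := by
  rw [(hf.hasFDerivAt_smoothed h0 h1 hL μ x).fderiv, ContinuousLinearMap.integral_apply]
  exact integrable_comp_affine (hf.expGrowth_fderiv h0 h1 hL) (measurable_fderiv ℝ f) x μ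

/-- The gradient of the smoothed function is the mean of the exact random gradient estimation. -/
lemma fderiv_smoothed_apply' (hf : HasHolderGradient f ν L) (h0 : 0 ≤ ν) (h1 : ν ≤ 1) (hL : 0 ≤ L)
    (hμ : μ ≠ 0) (x w : E) :
    fderiv ℝ (smoothed f μ) x w = μ⁻¹ * ∫ u, f (x + μ • u) * ⟪u, w⟫ ∂(stdGaussian E) := by
  have h := hasFDerivAt_integral_comp_affine' (hf.expGrowth h0 h1 hL) hf.measurable x hμ
  rw [← show smoothed f μ = _ from funext (smoothed_eq_integral f μ)] at h
  rw [h.fderiv, smul_apply, ContinuousLinearMap.integral_apply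
    (integrable_smul_innerSL ((hf.expGrowth h0 h1 hL).comp_affine x μ)
      (hf.measurable.comp (by fun_prop)))]
  simp

/-- The linear term ∇f(x)(μu) has mean zero and can be subtracted for free, leaving the Taylor
remainder and the moment of order 1 + ν ≤ 2. -/
lemma abs_smoothed_sub_le (hf : HasHolderGradient f ν L) (h0 : 0 ≤ ν) (h1 : ν ≤ 1) (hL : 0 ≤ L)
    (hμ : 0 ≤ μ) (hn : 0 < Module.finrank ℝ E) (x : E) :
    |smoothed f μ x - f x| ≤ gapBound ν L (Module.finrank ℝ E) μ := by
  have hi := integrable_comp_affine (hf.expGrowth h0 h1 hL) hf.measurable x μ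
  have hi' : Integrable (fun u => fderiv ℝ f x (μ • u)) (stdGaussian E) := by
    simp only [map_smul]
    exact (IsGaussian.integrable_dual _ _).smul μ
  have hz : ∫ u, fderiv ℝ f x (μ • u) ∂(stdGaussian E) = 0 := by
    simp only [map_smul]
    rw [integral_smul, integral_strongDual_stdGaussian, smul_zero]
  have e : smoothed f μ x - f x =
      ∫ u, (f (x + μ • u) - f x - fderiv ℝ f x (μ • u)) ∂(stdGaussian E) := by
    have hi₂ : Integrable (fun u => f (x + μ • u) - f x) (stdGaussian E) :=
      hi.sub (integrable_const _)
    rw [integral_sub hi₂ hi', integral_sub hi (integrable_const _), hz, smoothed_eq_integral]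
    simp
  have hp := (integrable_norm_rpow_stdGaussian (E := E) (by positivity : 0 ≤ 1 + ν)).const_mul
    (L / (1 + ν) * μ ^ (1 + ν))
  rw [e, ← Real.norm_eq_abs]
  refine (norm_integral_le_of_norm_le hp (Eventually.of_forall fun u => ?_)).trans ?_
  · have h := hf.abs_sub_sub_le h0 x (x + μ • u)
    rw [add_sub_cancel_left, norm_smul, Real.norm_of_nonneg hμ,
      Real.mul_rpow hμ (norm_nonneg _), ← mul_assoc] at h
    exact h
  · rw [integral_const_mul, gapBound]
    have h := integral_norm_rpow_le (E := E) (θ := (1 + ν) / 2) (by positivity) (by linarith) hn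
    rw [mul_div_cancel₀ _ two_ne_zero] at h
    gcongr

lemma norm_fderiv_smoothed_sub_le (hf : HasHolderGradient f ν L) (h0 : 0 ≤ ν) (h1 : ν ≤ 1)
    (hL : 0 ≤ L) (hμ : 0 ≤ μ) (hn : 0 < Module.finrank ℝ E) (x : E) :
    ‖fderiv ℝ (smoothed f μ) x - fderiv ℝ f x‖ ≤
      L * μ ^ ν * (Module.finrank ℝ E : ℝ) ^ (ν / 2) := by
  have hi := integrable_comp_affine (hf.expGrowth_fderiv h0 h1 hL) (measurable_fderiv ℝ f) x μ
  have e : fderiv ℝ (smoothed f μ) x - fderiv ℝ f x =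
      ∫ u, (fderiv ℝ f (x + μ • u) - fderiv ℝ f x) ∂(stdGaussian E) := by
    rw [integral_sub hi (integrable_const _), (hf.hasFDerivAt_smoothed h0 h1 hL μ x).fderiv]
    simp
  have hp := (integrable_norm_rpow_stdGaussian (E := E) h0).const_mul (L * μ ^ ν)
  rw [e]
  refine (norm_integral_le_of_norm_le hp (Eventually.of_forall fun u => ?_)).trans ?_
  · have h := hf.2 x (x + μ • u)
    rwa [add_sub_cancel_left, norm_smul, Real.norm_of_nonneg hμ,
      Real.mul_rpow hμ (norm_nonneg _), ← mul_assoc] at h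
  · rw [integral_const_mul]
    have h := integral_norm_rpow_le (E := E) (θ := ν / 2) (by positivity) (by linarith) hn
    rw [mul_div_cancel₀ _ two_ne_zero] at h
    gcongr

/-- The gradient of the smoothed function is Lipschitz continuous with constant `smoothConst`. -/
lemma smoothed_lipschitz (hf : HasHolderGradient f ν L) (h0 : 0 ≤ ν) (h1 : ν ≤ 1) (hL : 0 ≤ L)
    (hμ : 0 < μ) (hn : 0 < Module.finrank ℝ E) :
    HasHolderGradient (smoothed f μ) 1 (smoothConst ν L (Module.finrank ℝ E) μ) := by
  refine ⟨fun x => (hf.hasFDerivAt_smoothed h0 h1 hL μ x).differentiableAt, fun x y => ?_⟩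
  have hA : 0 ≤ smoothConst ν L (Module.finrank ℝ E) μ := by unfold smoothConst; positivity
  rw [Real.rpow_one]
  refine ContinuousLinearMap.opNorm_le_bound _ (by positivity) fun v => ?_
  -- The directional derivative of f_μ is itself a Gaussian average, of z ↦ ∇f(z)v. Its derivative
  -- is put on the density, so no second derivative of f is involved; bounding it gives the
  -- Lipschitz constant.
  have hFm : Measurable (fun z => fderiv ℝ f z v) := measurable_fderiv_apply_const ℝ f v
  have hF : ExpGrowth (fun z => fderiv ℝ f z v) :=
    ((hf.expGrowth_fderiv h0 h1 hL).norm.mul (ExpGrowth.const ‖v‖)).mono fun z => by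
      rw [norm_mul, norm_norm, norm_norm]
      exact ContinuousLinearMap.le_opNorm _ _
  have hder := fun z => hasFDerivAt_integral_comp_affine' hF hFm z hμ.ne'
  have hbound : ∀ z : E, ‖μ⁻¹ • ∫ u, (fderiv ℝ f (z + μ • u) v) • innerSL ℝ u ∂(stdGaussian E)‖ ≤
      smoothConst ν L (Module.finrank ℝ E) μ * ‖v‖ := by
    intro z
    have hi := integrable_smul_innerSL (hF.comp_affine z μ) (hFm.comp (by fun_prop))
    have hi' := integrable_smul_innerSL (ExpGrowth.const (E := E) (fderiv ℝ f z v))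
      measurable_const
    -- As u has mean zero, ∇f(z)v may be subtracted from the integrand, which produces a Hölder
    -- increment of ∇f.
    have hz : ∫ u, (fderiv ℝ f z v) • innerSL ℝ u ∂(stdGaussian E) = 0 := by
      rw [integral_smul, (innerSL ℝ (E := E)).integral_comp_comm IsGaussian.integrable_fun_id,
        integral_id_stdGaussian, map_zero, smul_zero]
    have e : ∫ u, (fderiv ℝ f (z + μ • u) v) • innerSL ℝ u ∂(stdGaussian E) =
        ∫ u, ((fderiv ℝ f (z + μ • u) - fderiv ℝ f z) v) • innerSL ℝ u ∂(stdGaussian E) := by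
      simp_rw [sub_apply, sub_smul]
      rw [integral_sub hi hi', hz, sub_zero]
    have hp := (integrable_norm_rpow_stdGaussian (E := E) (by positivity : 0 ≤ 1 + ν)).const_mul
      (L * μ ^ ν * ‖v‖)
    have hle : ‖∫ u, (fderiv ℝ f (z + μ • u) v) • innerSL ℝ u ∂(stdGaussian E)‖ ≤
        L * μ ^ ν * ‖v‖ * (Module.finrank ℝ E : ℝ) ^ ((1 + ν) / 2) := by
      rw [e]
      refine (norm_integral_le_of_norm_le hp (Eventually.of_forall fun u => ?_)).trans ?_
      · rw [norm_smul, innerSL_apply_norm]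
        have h := hf.2 z (z + μ • u)
        rw [add_sub_cancel_left, norm_smul, Real.norm_of_nonneg hμ.le,
          Real.mul_rpow hμ.le (norm_nonneg _), ← mul_assoc] at h
        calc _ ≤ (L * μ ^ ν * ‖u‖ ^ ν * ‖v‖) * ‖u‖ := by
              gcongr
              exact ContinuousLinearMap.le_of_opNorm_le _ h v
          _ = L * μ ^ ν * ‖v‖ * (‖u‖ ^ ν * ‖u‖) := by ring
          _ = _ := by rw [add_comm 1 ν, Real.rpow_add_one' (norm_nonneg _) (by positivity)]
      · rw [integral_const_mul]
        have h := integral_norm_rpow_le (E := E) (θ := (1 + ν) / 2) (by positivity) (by linarith) hn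
        rw [mul_div_cancel₀ _ two_ne_zero] at h
        gcongr
    rw [norm_smul, norm_inv, Real.norm_of_nonneg hμ.le]
    calc _ ≤ μ⁻¹ * (L * μ ^ ν * ‖v‖ * (Module.finrank ℝ E : ℝ) ^ ((1 + ν) / 2)) := by gcongr
      _ = _ := by
        rw [smoothConst, Real.rpow_sub hμ, Real.rpow_one]
        have := Real.rpow_pos_of_pos hμ ν
        field_simp
  have h := Convex.norm_image_sub_le_of_norm_hasFDerivWithin_le (s := Set.univ)
    (fun z _ => (hder z).hasFDerivWithinAt) (fun z _ => hbound z) convex_univ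
    (Set.mem_univ x) (Set.mem_univ y)
  rw [sub_apply, hf.fderiv_smoothed_apply h0 h1 hL,
    hf.fderiv_smoothed_apply h0 h1 hL]
  exact h.trans_eq (by ring)

end HasHolderGradient

end Smoothing

section Step

variable {E : Type*} [NormedAddCommGroup E] [InnerProductSpace ℝ E] [FiniteDimensional ℝ E]
  [MeasurableSpace E] [BorelSpace E]

/-! ### One step of the method -/

/-- The finite difference quotient of the oracle. -/
def oracleSlope (ft : E → ℝ) (μ : ℝ) (x u : E) : ℝ := (ft (x + μ • u) - ft x) / μ

/-- One step of the method from `x` in the direction `u`. -/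
def oracleStep (ft : E → ℝ) (μ h : ℝ) (x u : E) : E := x - (h * oracleSlope ft μ x u) • u

lemma iterate_succ (ft : E → ℝ) (μ : ℝ) (h : ℝ) (x₀ : E) (u : ℕ → E) (k : ℕ) :
    iterate ft μ (fun _ => h) x₀ u (k + 1) =
      oracleStep ft μ h (iterate ft μ (fun _ => h) x₀ u k) (u k) := by
  rw [iterate, gradEst, map_smul, LinearIsometryEquiv.symm_apply_apply, smul_smul]
  rfl

lemma measurable_oracleSlope {ft : E → ℝ} (hm : Measurable ft) (μ : ℝ) :
    Measurable (fun p : E × E => oracleSlope ft μ p.1 p.2) :=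
  ((hm.comp (by fun_prop)).sub (hm.comp measurable_fst)).div_const μ

lemma measurable_oracleStep {ft : E → ℝ} (hm : Measurable ft) (μ h : ℝ) :
    Measurable (fun p : E × E => oracleStep ft μ h p.1 p.2) :=
  measurable_fst.sub (((measurable_oracleSlope hm μ).const_mul h).smul measurable_snd)

lemma measurable_oracleSlope_right {ft : E → ℝ} (hm : Measurable ft) (μ : ℝ) (x : E) :
    Measurable (fun u => oracleSlope ft μ x u) :=
  (measurable_oracleSlope hm μ).comp measurable_prodMk_left

lemma IsInexactOracle.expGrowth {f ft : E → ℝ} {δ : ℝ} (hft : IsInexactOracle f ft δ)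
    (hf : ExpGrowth f) : ExpGrowth ft := by
  refine (hf.norm.add (ExpGrowth.const δ)).mono fun z => ?_
  have h := hft.2.2 z
  have h0 := hft.1
  rw [abs_sub_comm] at h
  rw [Real.norm_eq_abs, Real.norm_eq_abs, Real.norm_eq_abs]
  refine le_trans ?_ (le_abs_self _)
  linarith [abs_sub_abs_le_abs_sub (ft z) (f z)]

lemma ExpGrowth.oracleSlope {ft : E → ℝ} (hft : ExpGrowth ft) (μ : ℝ) (x : E) :
    ExpGrowth (fun u => ZerothOrder.oracleSlope ft μ x u) := by
  unfold ZerothOrder.oracleSlope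
  simp_rw [div_eq_mul_inv]
  exact ((hft.comp_affine x μ).sub (ExpGrowth.const _)).mul (ExpGrowth.const _)

variable {f ft : E → ℝ} {ν L μ δ : ℝ}

lemma IsInexactOracle.abs_slope_sub_le (hft : IsInexactOracle f ft δ) (hμ : 0 < μ) (x u : E) :
    |oracleSlope ft μ x u - oracleSlope f μ x u| ≤ 2 * (δ / μ) := by
  have h1 := hft.2.2 (x + μ • u)
  have h2 := hft.2.2 x
  rw [oracleSlope, oracleSlope, ← sub_div, abs_div, abs_of_pos hμ, ← mul_div_assoc]
  gcongr
  rw [abs_le] at *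
  constructor <;> linarith [h1.1, h1.2, h2.1, h2.2]

/-- The second moment of the gradient estimation is controlled by the gradient of the smoothed
function. -/
lemma integral_oracleSlope_sq_mul_le (hf : HasHolderGradient f ν L) (h0 : 0 ≤ ν) (h1 : ν ≤ 1)
    (hL : 0 ≤ L) (hμ : 0 < μ) (hn : 0 < Module.finrank ℝ E) (hft : IsInexactOracle f ft δ) (x : E) :
    Integrable (fun u => oracleSlope ft μ x u ^ 2 * ‖u‖ ^ 2) (stdGaussian E) ∧
    ∫ u, oracleSlope ft μ x u ^ 2 * ‖u‖ ^ 2 ∂(stdGaussian E) ≤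
      16 * Module.finrank ℝ E * ‖fderiv ℝ (smoothed f μ) x‖ ^ 2 +
      (448 * L ^ 2 * (μ ^ ν) ^ 2 * (Module.finrank ℝ E : ℝ) ^ 2 * (Module.finrank ℝ E : ℝ) ^ ν +
        16 * Module.finrank ℝ E * (δ / μ) ^ 2) := by
  have hn1 : (1 : ℝ) ≤ Module.finrank ℝ E := by exact_mod_cast hn
  set n : ℝ := (Module.finrank ℝ E : ℝ) with hndef
  have hn0 : 0 < n := by linarith
  have hi : Integrable (fun u => oracleSlope ft μ x u ^ 2 * ‖u‖ ^ 2) (stdGaussian E) := by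
    have hg := (hft.expGrowth (hf.expGrowth h0 h1 hL)).oracleSlope μ x
    simp_rw [sq]
    have hm := measurable_oracleSlope_right hft.2.1 μ x
    exact ((hg.mul hg).mul (ExpGrowth.norm_id.mul ExpGrowth.norm_id)).integrable (by fun_prop)
  refine ⟨hi, ?_⟩
  set g := fderiv ℝ (smoothed f μ) x
  -- The slope splits as ⟨a, u⟩ + ⟨b, u⟩ + r + e: the gradient of f_μ, the discrepancy ∇f - ∇f_μ,
  -- the Taylor remainder of f, and the noise.
  set a := (InnerProductSpace.toDual ℝ E).symm g with ha
  set b := (InnerProductSpace.toDual ℝ E).symm (fderiv ℝ f x - g) with hb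
  have hna : ‖a‖ = ‖g‖ := LinearIsometryEquiv.norm_map _ _
  have hnb : ‖b‖ ≤ L * μ ^ ν * n ^ (ν / 2) := by
    rw [hb, LinearIsometryEquiv.norm_map, norm_sub_rev]
    exact hf.norm_fderiv_smoothed_sub_le h0 h1 hL hμ.le hn x
  have hab : ∀ u, fderiv ℝ f x u = ⟪a, u⟫ + ⟪b, u⟫ := fun u => by
    rw [ha, hb, InnerProductSpace.toDual_symm_apply, InnerProductSpace.toDual_symm_apply, sub_apply]
    ring
  have hpt : ∀ u, oracleSlope ft μ x u ^ 2 * ‖u‖ ^ 2 ≤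
      4 * (⟪a, u⟫ ^ 2 * ‖u‖ ^ 2) + 4 * (⟪b, u⟫ ^ 2 * ‖u‖ ^ 2) +
      4 * (L * μ ^ ν) ^ 2 * (‖u‖ ^ 4 * ‖u‖ ^ (2 * ν)) + 16 * (δ / μ) ^ 2 * ‖u‖ ^ 2 := by
    intro u
    set r := oracleSlope f μ x u - fderiv ℝ f x u with hr
    set e := oracleSlope ft μ x u - oracleSlope f μ x u with he
    have hre : oracleSlope ft μ x u = ⟪a, u⟫ + ⟪b, u⟫ + r + e := by rw [← hab]; ring
    have he2 : e ^ 2 ≤ 4 * (δ / μ) ^ 2 := by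
      rw [← sq_abs]
      calc |e| ^ 2 ≤ (2 * (δ / μ)) ^ 2 := by gcongr; exact hft.abs_slope_sub_le hμ x u
        _ = _ := by ring
    have hr1 : |r| ≤ L * μ ^ ν * ‖u‖ ^ (1 + ν) := by
      have h := hf.abs_sub_sub_le h0 x (x + μ • u)
      rw [add_sub_cancel_left, norm_smul, Real.norm_of_nonneg hμ.le,
        Real.mul_rpow hμ.le (norm_nonneg _), map_smul, smul_eq_mul] at h
      have e1 : r = (f (x + μ • u) - f x - μ * fderiv ℝ f x u) / μ := by
        rw [hr, oracleSlope]; field_simp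
      rw [e1, abs_div, abs_of_pos hμ, div_le_iff₀ hμ]
      refine h.trans ?_
      rw [Real.rpow_add hμ, Real.rpow_one]
      have : L / (1 + ν) ≤ L := div_le_self hL (by linarith)
      calc _ ≤ L * (μ * μ ^ ν * ‖u‖ ^ (1 + ν)) := by gcongr
        _ = _ := by ring
    have hr2 : r ^ 2 * ‖u‖ ^ 2 ≤ (L * μ ^ ν) ^ 2 * (‖u‖ ^ 4 * ‖u‖ ^ (2 * ν)) := by
      rw [← sq_abs]
      calc |r| ^ 2 * ‖u‖ ^ 2 ≤ (L * μ ^ ν * ‖u‖ ^ (1 + ν)) ^ 2 * ‖u‖ ^ 2 := by gcongr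
        _ = (L * μ ^ ν * (‖u‖ ^ ν * ‖u‖)) ^ 2 * ‖u‖ ^ 2 := by
          rw [add_comm 1 ν, Real.rpow_add_one' (norm_nonneg _) (by positivity)]
        _ = (L * μ ^ ν) ^ 2 * (‖u‖ ^ 4 * (‖u‖ ^ ν) ^ 2) := by ring
        _ = _ := by
          rw [mul_comm 2 ν, Real.rpow_mul (norm_nonneg _)]
          norm_num
    have hsq : (⟪a, u⟫ + ⟪b, u⟫ + r + e) ^ 2 ≤ 4 * (⟪a, u⟫ ^ 2 + ⟪b, u⟫ ^ 2 + r ^ 2 + e ^ 2) := by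
      nlinarith [sq_nonneg (⟪a, u⟫ - ⟪b, u⟫), sq_nonneg (⟪a, u⟫ - r), sq_nonneg (⟪a, u⟫ - e),
        sq_nonneg (⟪b, u⟫ - r), sq_nonneg (⟪b, u⟫ - e), sq_nonneg (r - e)]
    rw [hre]
    calc _ ≤ 4 * (⟪a, u⟫ ^ 2 + ⟪b, u⟫ ^ 2 + r ^ 2 + e ^ 2) * ‖u‖ ^ 2 := by gcongr
      _ = 4 * (⟪a, u⟫ ^ 2 * ‖u‖ ^ 2) + 4 * (⟪b, u⟫ ^ 2 * ‖u‖ ^ 2) + 4 * (r ^ 2 * ‖u‖ ^ 2) +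
          4 * e ^ 2 * ‖u‖ ^ 2 := by ring
      _ ≤ 4 * (⟪a, u⟫ ^ 2 * ‖u‖ ^ 2) + 4 * (⟪b, u⟫ ^ 2 * ‖u‖ ^ 2) +
          4 * ((L * μ ^ ν) ^ 2 * (‖u‖ ^ 4 * ‖u‖ ^ (2 * ν))) +
          4 * (4 * (δ / μ) ^ 2) * ‖u‖ ^ 2 := by gcongr
      _ = _ := by ring
  have hia := (integrable_inner_sq_mul_norm_sq a).const_mul 4
  have hib := (integrable_inner_sq_mul_norm_sq b).const_mul 4
  obtain ⟨hi6, h6⟩ := integral_norm_pow_four_mul_rpow_le (E := E) h0 h1 hn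
  have hir := hi6.const_mul (4 * (L * μ ^ ν) ^ 2)
  have hie := (integrable_norm_pow_stdGaussian (E := E) 2).const_mul (16 * (δ / μ) ^ 2)
  refine (integral_mono hi (((hia.add hib).add hir).add hie) hpt).trans ?_
  rw [integral_add' ((hia.add hib).add hir) hie, integral_add' (hia.add hib) hir,
    integral_add' hia hib]
  simp only [integral_const_mul]
  have ha2 := integral_inner_sq_mul_norm_sq_le a
  have hb2 := integral_inner_sq_mul_norm_sq_le b
  rw [integral_norm_sq_stdGaussian]
  rw [← hndef] at ha2 hb2 h6 ⊢
  have hnn : (n ^ (ν / 2)) ^ 2 = n ^ ν := by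
    rw [← Real.rpow_natCast, ← Real.rpow_mul hn0.le]; norm_num
  have hb3 : ‖b‖ ^ 2 ≤ (L * μ ^ ν) ^ 2 * n ^ ν := by
    calc ‖b‖ ^ 2 ≤ (L * μ ^ ν * n ^ (ν / 2)) ^ 2 := by gcongr
      _ = _ := by rw [mul_pow, hnn]
  have hnsq : n ≤ n ^ 2 := by nlinarith
  calc _ ≤ 4 * (4 * n * ‖a‖ ^ 2) + 4 * (4 * n * ‖b‖ ^ 2) +
        4 * (L * μ ^ ν) ^ 2 * (108 * n ^ 2 * n ^ ν) + 16 * (δ / μ) ^ 2 * n := by gcongr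
    _ ≤ 4 * (4 * n * ‖g‖ ^ 2) + 4 * (4 * n ^ 2 * ((L * μ ^ ν) ^ 2 * n ^ ν)) +
        4 * (L * μ ^ ν) ^ 2 * (108 * n ^ 2 * n ^ ν) + 16 * (δ / μ) ^ 2 * n := by
        rw [hna]; gcongr
    _ = _ := by ring

/-- Up to the noise, the gradient estimation points in the direction of the gradient. -/
lemma le_integral_oracleSlope_mul_fderiv (hf : HasHolderGradient f ν L) (h0 : 0 ≤ ν) (h1 : ν ≤ 1)
    (hL : 0 ≤ L) (hμ : 0 < μ) (hft : IsInexactOracle f ft δ) (x : E) :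
    Integrable (fun u => oracleSlope ft μ x u * fderiv ℝ (smoothed f μ) x u) (stdGaussian E) ∧
    3 / 4 * ‖fderiv ℝ (smoothed f μ) x‖ ^ 2 - 4 * (δ / μ) ^ 2 ≤
      ∫ u, oracleSlope ft μ x u * fderiv ℝ (smoothed f μ) x u ∂(stdGaussian E) := by
  set g := fderiv ℝ (smoothed f μ) x with hgdef
  set a := (InnerProductSpace.toDual ℝ E).symm g with ha
  have hna : ‖a‖ = ‖g‖ := LinearIsometryEquiv.norm_map _ _
  have hga : ∀ u, g u = ⟪a, u⟫ := fun u => by rw [ha, InnerProductSpace.toDual_symm_apply]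
  have hfe := hf.expGrowth h0 h1 hL
  have hgi : ∀ {F : E → ℝ}, ExpGrowth F → Measurable F →
      Integrable (fun u => oracleSlope F μ x u * ⟪a, u⟫) (stdGaussian E) := by
    intro F hF hFm
    have hm := measurable_oracleSlope_right hFm μ x
    exact ((hF.oracleSlope μ x).mul (ExpGrowth.inner_left a)).integrable (by fun_prop)
  have hi := hgi (hft.expGrowth hfe) hft.2.1
  have hi' := hgi hfe hf.measurable
  simp_rw [hga]
  refine ⟨hi, ?_⟩
  -- The base value f(x) drops out because ⟨u, a⟩ has mean zero; integration by parts identifies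
  -- what remains.
  have hmean : ∫ u, oracleSlope f μ x u * ⟪a, u⟫ ∂(stdGaussian E) = ‖g‖ ^ 2 := by
    have h2 : ‖g‖ ^ 2 = g a := by rw [hga, real_inner_self_eq_norm_sq, hna]
    have hia : Integrable (fun u => f x * ⟪u, a⟫) (stdGaussian E) := by
      simp_rw [real_inner_comm a]
      exact ((ExpGrowth.inner_left a).integrable (by fun_prop)).const_mul _
    have hif : Integrable (fun u => f (x + μ • u) * ⟪u, a⟫) (stdGaussian E) := by
      simp_rw [real_inner_comm a]
      have hm : Measurable (fun u => f (x + μ • u)) := hf.measurable.comp (by fun_prop)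
      exact ((hfe.comp_affine x μ).mul (ExpGrowth.inner_left a)).integrable
        (hm.mul (by fun_prop)).aestronglyMeasurable
    rw [h2, hgdef, hf.fderiv_smoothed_apply' h0 h1 hL hμ.ne', ← integral_const_mul]
    calc _ = ∫ u, (μ⁻¹ * (f (x + μ • u) * ⟪u, a⟫) - μ⁻¹ * (f x * ⟪u, a⟫)) ∂(stdGaussian E) := by
          congr 1
          ext u
          rw [oracleSlope, real_inner_comm]
          ring
      _ = _ := by
          rw [integral_sub (hif.const_mul _) (hia.const_mul _), integral_const_mul,
            integral_const_mul, integral_const_mul (f x), integral_inner_stdGaussian]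
          simp
  have hia := (integrable_inner_pow_stdGaussian a 2).const_mul (1 / 4)
  have hc : Integrable (fun _ : E => 4 * (δ / μ) ^ 2) (stdGaussian E) := integrable_const _
  -- The noise may be correlated with u, so its term is bounded pointwise by e⟨a, u⟩ ≥ -⟨a, u⟩²/4 -
  -- e².
  have h := integral_mono ((hi'.sub hia).sub hc) hi fun u => by
    have he := hft.abs_slope_sub_le hμ x u
    set e := oracleSlope ft μ x u - oracleSlope f μ x u with hedef
    have he2 : e ^ 2 ≤ 4 * (δ / μ) ^ 2 := by
      rw [← sq_abs]
      calc |e| ^ 2 ≤ (2 * (δ / μ)) ^ 2 := by gcongr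
        _ = _ := by ring
    have : oracleSlope ft μ x u = oracleSlope f μ x u + e := by rw [hedef]; ring
    simp only [Pi.sub_apply, this]
    nlinarith [sq_nonneg (⟪a, u⟫ / 2 + e)]
  rw [integral_sub' (hi'.sub hia) hc, integral_sub' hi' hia, hmean, integral_const_mul,
    integral_inner_sq_stdGaussian, hna] at h
  simp only [integral_const, probReal_univ, one_smul] at h
  linarith

/-- The error of one step of the method, for the product `θ` of the step size and the Lipschitz
constant. -/
def stepError (ν L : ℝ) (n : ℕ) (μ δ θ : ℝ) : ℝ :=
  4 * (δ / μ) ^ 2 + θ / 2 * (448 * L ^ 2 * (μ ^ ν) ^ 2 * (n : ℝ) ^ 2 * (n : ℝ) ^ ν +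
    16 * n * (δ / μ) ^ 2)

/-- Expected decrease of the smoothed function in one step. -/
lemma integral_smoothed_oracleStep_le (hf : HasHolderGradient f ν L) (h0 : 0 ≤ ν) (h1 : ν ≤ 1)
    (hL : 0 ≤ L) (hμ : 0 < μ) (hn : 0 < Module.finrank ℝ E) (hft : IsInexactOracle f ft δ)
    {h θ : ℝ} (hh : 0 ≤ h) (hθ : smoothConst ν L (Module.finrank ℝ E) μ * h = θ)
    (hθn : θ * (80 * Module.finrank ℝ E) ≤ 1) (x : E) :
    ∫ u, smoothed f μ (oracleStep ft μ h x u) ∂(stdGaussian E) ≤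
      smoothed f μ x - h / 2 * ‖fderiv ℝ (smoothed f μ) x‖ ^ 2 +
        h * stepError ν L (Module.finrank ℝ E) μ δ θ := by
  have hlip := hf.smoothed_lipschitz h0 h1 hL hμ hn
  set A := smoothConst ν L (Module.finrank ℝ E) μ
  obtain ⟨hi2, hs2⟩ := integral_oracleSlope_sq_mul_le hf h0 h1 hL hμ hn hft x
  obtain ⟨hi1, hs1⟩ := le_integral_oracleSlope_mul_fderiv hf h0 h1 hL hμ hft x
  set g := fderiv ℝ (smoothed f μ) x
  set n : ℝ := (Module.finrank ℝ E : ℝ) with hndef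
  have hA : 0 ≤ A := by unfold A smoothConst; positivity
  -- The two-sided form is kept because it also yields integrability of f_μ after the step.
  have hpt : ∀ u, |smoothed f μ (oracleStep ft μ h x u) - smoothed f μ x +
      h * (oracleSlope ft μ x u * g u)| ≤
      A / 2 * h ^ 2 * (oracleSlope ft μ x u ^ 2 * ‖u‖ ^ 2) := by
    intro u
    have hT := hlip.abs_sub_sub_le zero_le_one x (oracleStep ft μ h x u)
    have e : oracleStep ft μ h x u - x = -((h * oracleSlope ft μ x u) • u) := by
      rw [oracleStep]; abel
    rw [e, map_neg, map_smul, norm_neg, norm_smul, sub_neg_eq_add, smul_eq_mul, mul_assoc,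
      one_add_one_eq_two, Real.rpow_two, mul_pow, Real.norm_eq_abs, sq_abs] at hT
    exact hT.trans_eq (by ring)
  have hi3 := hi1.const_mul h
  have hi4 := hi2.const_mul (A / 2 * h ^ 2)
  have hi6 : Integrable (fun u => smoothed f μ x - h * (oracleSlope ft μ x u * g u))
      (stdGaussian E) := (integrable_const _).sub hi3
  have hmeas : Measurable (fun u => smoothed f μ (oracleStep ft μ h x u)) :=
    hlip.measurable.comp ((measurable_oracleStep hft.2.1 μ h).comp measurable_prodMk_left)
  have hi5 : Integrable (fun u => smoothed f μ (oracleStep ft μ h x u)) (stdGaussian E) := by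
    have := hi4.mono' (f := fun u => smoothed f μ (oracleStep ft μ h x u) - smoothed f μ x +
      h * (oracleSlope ft μ x u * g u))
      ((hmeas.aestronglyMeasurable.sub aestronglyMeasurable_const).add hi3.1)
      (Eventually.of_forall hpt)
    refine ((this.sub hi3).add (integrable_const (smoothed f μ x))).congr
      (Eventually.of_forall fun u => ?_)
    simp only [Pi.add_apply, Pi.sub_apply]
    ring
  refine (integral_mono hi5 (hi6.add hi4) fun u => ?_).trans ?_
  · have := (abs_le.1 (hpt u)).2
    simp only [Pi.add_apply]
    linarith
  · rw [integral_add' hi6 hi4, integral_sub (integrable_const _) hi3,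
      integral_const_mul, integral_const_mul]
    simp only [integral_const, probReal_univ, one_smul]
    have hθ0 : 0 ≤ θ := hθ ▸ mul_nonneg hA hh
    have e : A / 2 * h ^ 2 = h * (θ / 2) := by rw [← hθ]; ring
    have hb1 := mul_le_mul_of_nonneg_left hs1 hh
    have hb2 := mul_le_mul_of_nonneg_left hs2 (by positivity : 0 ≤ h * (θ / 2))
    -- The quadratic term contributes (hθ/2) · 16n‖g‖² ≤ (h/10)‖g‖²; subtracted from (3h/4)‖g‖² it
    -- leaves more than (h/2)‖g‖².
    have hb3 : h * (θ * (80 * n) * ‖g‖ ^ 2) ≤ h * (1 * ‖g‖ ^ 2) := by gcongr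
    have hb4 : 0 ≤ h * ‖g‖ ^ 2 := by positivity
    rw [e, stepError]
    linarith

end Step

section Iteration

variable {E : Type*} [NormedAddCommGroup E] [InnerProductSpace ℝ E] [FiniteDimensional ℝ E]
  [MeasurableSpace E] [BorelSpace E]

/-! ### The process -/

lemma measurable_iterate {ft : E → ℝ} (hm : Measurable ft) (μ h : ℝ) (x₀ : E) (k : ℕ) :
    Measurable (fun u : ℕ → E => iterate ft μ (fun _ => h) x₀ u k) := by
  induction k with
  | zero => exact measurable_const
  | succ k ih =>
    simp_rw [iterate_succ]
    exact (measurable_oracleStep hm μ h).comp (ih.prodMk (measurable_pi_apply k))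

lemma iterate_congr (ft : E → ℝ) (μ : ℝ) (h : ℕ → ℝ) (x₀ : E) {u u' : ℕ → E} {k : ℕ}
    (huu' : ∀ j < k, u j = u' j) : iterate ft μ h x₀ u k = iterate ft μ h x₀ u' k := by
  induction k with
  | zero => rfl
  | succ k ih =>
    rw [iterate, iterate, ih fun j hj => huu' j (hj.trans k.lt_succ_self), huu' k k.lt_succ_self]

variable {Ω : Type*} [MeasurableSpace Ω] {P : Measure Ω} [IsProbabilityMeasure P] {U : ℕ → Ω → E}

lemma aemeasurable_iterate {ft : E → ℝ} (hm : Measurable ft) (hU : ∀ k, AEMeasurable (U k) P)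
    (μ h : ℝ) (x₀ : E) (k : ℕ) :
    AEMeasurable (fun ω => iterate ft μ (fun _ => h) x₀ (fun j => U j ω) k) P :=
  (measurable_iterate hm μ h x₀ k).comp_aemeasurable (aemeasurable_pi_lambda _ hU)

/-- The current iterate is independent of the next direction. -/
lemma indepFun_iterate {ft : E → ℝ} (hm : Measurable ft) (hU : ∀ k, AEMeasurable (U k) P)
    (hind : iIndepFun U P) (μ h : ℝ) (x₀ : E) (k : ℕ) :
    IndepFun (fun ω => iterate ft μ (fun _ => h) x₀ (fun j => U j ω) k) (U k) P := by
  have hI := hind.indepFun_finset₀ (Finset.range k) {k} (by simp) hU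
  -- Padding the first k directions with zeros is harmless, since the k-th iterate depends on no
  -- others.
  let ext : (Finset.range k → E) → ℕ → E :=
    fun v j => if hj : j ∈ Finset.range k then v ⟨j, hj⟩ else 0
  have hext : Measurable ext := by
    refine measurable_pi_lambda _ fun j => ?_
    by_cases hj : j ∈ Finset.range k
    · simp only [ext, hj, dif_pos]
      exact measurable_pi_apply _
    · simp only [ext, hj, dif_neg, not_false_eq_true]
      exact measurable_const
  have h2 := hI.comp ((measurable_iterate hm μ h x₀ k).comp hext)
    (measurable_pi_apply (⟨k, Finset.mem_singleton_self k⟩ : ({k} : Finset ℕ)))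
  refine h2.congr (Eventually.of_forall fun ω => ?_) (Eventually.of_forall fun ω => rfl)
  refine iterate_congr ft μ _ x₀ fun j hj => ?_
  simp [ext, hj]

/-- The product form of the joint law lets Fubini apply estimates for a fixed x and a Gaussian u to
the random iterate, in place of conditional expectations. -/
lemma map_iterate_prodMk {ft : E → ℝ} (hm : Measurable ft)
    (hU : ∀ k, HasLaw (U k) (stdGaussian E) P)
    (hind : iIndepFun U P) (μ h : ℝ) (x₀ : E) (k : ℕ) :
    P.map (fun ω => (iterate ft μ (fun _ => h) x₀ (fun j => U j ω) k, U k ω)) =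
      (P.map (fun ω => iterate ft μ (fun _ => h) x₀ (fun j => U j ω) k)).prod (stdGaussian E) := by
  have hU' := fun k => (hU k).aemeasurable
  rw [(indepFun_iff_map_prod_eq_prod_map_map (aemeasurable_iterate hm hU' μ h x₀ k) (hU' k)).1
    (indepFun_iterate hm hU' hind μ h x₀ k), (hU k).map_eq]

variable {f ft : E → ℝ} {ν L μ δ : ℝ}

lemma HasHolderGradient.norm_fderiv_sq_le {F : E → ℝ} {A : ℝ} (hF : HasHolderGradient F 1 A)
    (x : E) : ‖fderiv ℝ F x‖ ^ 2 ≤ 2 * ‖fderiv ℝ F 0‖ ^ 2 + 2 * A ^ 2 * ‖x‖ ^ 2 := by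
  have h := hF.2 0 x
  rw [Real.rpow_one, sub_zero] at h
  have h2 : ‖fderiv ℝ F x‖ ≤ ‖fderiv ℝ F 0‖ + A * ‖x‖ := by
    have := norm_le_norm_add_norm_sub' (fderiv ℝ F x) (fderiv ℝ F 0)
    linarith
  calc _ ≤ (‖fderiv ℝ F 0‖ + A * ‖x‖) ^ 2 := by gcongr
    _ ≤ _ := by nlinarith [sq_nonneg (‖fderiv ℝ F 0‖ - A * ‖x‖)]

lemma measurable_norm_fderiv_sq {F : E → ℝ} :
    Measurable (fun x => ‖fderiv ℝ F x‖ ^ 2) := (measurable_fderiv ℝ F).norm.pow_const 2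

lemma HasHolderGradient.integrable_norm_fderiv_sq {F : E → ℝ} {A : ℝ}
    (hF : HasHolderGradient F 1 A) {Q : Measure E} [IsFiniteMeasure Q]
    (hQ : Integrable (fun x => ‖x‖ ^ 2) Q) : Integrable (fun x => ‖fderiv ℝ F x‖ ^ 2) Q := by
  refine ((integrable_const (2 * ‖fderiv ℝ F 0‖ ^ 2)).add (hQ.const_mul (2 * A ^ 2))).mono'
    measurable_norm_fderiv_sq.aestronglyMeasurable (Eventually.of_forall fun x => ?_)
  rw [Real.norm_of_nonneg (sq_nonneg _)]
  exact hF.norm_fderiv_sq_le x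

lemma HasHolderGradient.abs_le {F : E → ℝ} {A : ℝ} (hF : HasHolderGradient F 1 A)
    (x : E) : |F x| ≤ |F 0| + ‖fderiv ℝ F 0‖ + (‖fderiv ℝ F 0‖ + A / 2) * ‖x‖ ^ 2 := by
  have h := hF.abs_sub_sub_le zero_le_one 0 x
  rw [sub_zero, one_add_one_eq_two, Real.rpow_two] at h
  have h2 := (fderiv ℝ F 0).le_opNorm x
  rw [Real.norm_eq_abs] at h2
  have h3 : ‖x‖ ≤ 1 + ‖x‖ ^ 2 := by nlinarith [sq_nonneg (‖x‖ - 1)]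
  have h4 : ‖fderiv ℝ F 0‖ * ‖x‖ ≤ ‖fderiv ℝ F 0‖ * (1 + ‖x‖ ^ 2) := by gcongr
  have h5 : |F x| ≤ |F 0| + |fderiv ℝ F 0 x| + |F x - F 0 - fderiv ℝ F 0 x| := by
    have := abs_add_three (F 0) (fderiv ℝ F 0 x) (F x - F 0 - fderiv ℝ F 0 x)
    rwa [show F 0 + fderiv ℝ F 0 x + (F x - F 0 - fderiv ℝ F 0 x) = F x by ring] at this
  linarith

/-- The iterates are square-integrable. -/
lemma integrable_norm_sq_iterate (hf : HasHolderGradient f ν L) (h0 : 0 ≤ ν) (h1 : ν ≤ 1)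
    (hL : 0 ≤ L) (hμ : 0 < μ) (hn : 0 < Module.finrank ℝ E) (hft : IsInexactOracle f ft δ)
    (hU : ∀ k, HasLaw (U k) (stdGaussian E) P) (hind : iIndepFun U P) (h : ℝ) (x₀ : E) (k : ℕ) :
    Integrable (fun ω => ‖iterate ft μ (fun _ => h) x₀ (fun j => U j ω) k‖ ^ 2) P := by
  have hU' := fun k => (hU k).aemeasurable
  induction k with
  | zero => simp [iterate]
  | succ k ih =>
    have hX := aemeasurable_iterate hft.2.1 hU' μ h x₀ k
    have hlaw := map_iterate_prodMk hft.2.1 hU hind μ h x₀ k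
    set X := fun ω => iterate ft μ (fun _ => h) x₀ (fun j => U j ω) k with hXdef
    have : IsProbabilityMeasure (P.map X) := Measure.isProbabilityMeasure_map hX
    have hlip := hf.smoothed_lipschitz h0 h1 hL hμ hn
    set A := smoothConst ν L (Module.finrank ℝ E) μ
    have hA : 0 ≤ A := by unfold A smoothConst; positivity
    have hXm : Integrable (fun x => ‖x‖ ^ 2) (P.map X) := by
      rw [integrable_map_measure (by fun_prop) hX]
      exact ih
    have hqm : Measurable (fun p : E × E => oracleSlope ft μ p.1 p.2 ^ 2 * ‖p.2‖ ^ 2) :=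
      ((measurable_oracleSlope hft.2.1 μ).pow_const 2).mul (by fun_prop)
    -- Given x, the second moment of the step is bounded by a multiple of ‖∇f_μ(x)‖² plus a
    -- constant, hence quadratically in x; this closes the induction.
    have hq : Integrable (fun p : E × E => oracleSlope ft μ p.1 p.2 ^ 2 * ‖p.2‖ ^ 2)
        ((P.map X).prod (stdGaussian E)) := by
      rw [integrable_prod_iff hqm.aestronglyMeasurable]
      refine ⟨Eventually.of_forall fun x =>
        (integral_oracleSlope_sq_mul_le hf h0 h1 hL hμ hn hft x).1, ?_⟩
      have hint : Integrable (fun x =>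
          ∫ u, oracleSlope ft μ x u ^ 2 * ‖u‖ ^ 2 ∂(stdGaussian E)) (P.map X) := by
        refine (((hlip.integrable_norm_fderiv_sq hXm).const_mul
          (16 * (Module.finrank ℝ E : ℝ))).add (integrable_const
            (448 * L ^ 2 * (μ ^ ν) ^ 2 * (Module.finrank ℝ E : ℝ) ^ 2 *
              (Module.finrank ℝ E : ℝ) ^ ν + 16 * Module.finrank ℝ E * (δ / μ) ^ 2))).mono'
          hqm.stronglyMeasurable.integral_prod_right.aestronglyMeasurable
          (Eventually.of_forall fun x => ?_)
        rw [Real.norm_of_nonneg (integral_nonneg fun u => by positivity)]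
        exact (integral_oracleSlope_sq_mul_le hf h0 h1 hL hμ hn hft x).2
      refine hint.congr (Eventually.of_forall fun x => ?_)
      simp only [norm_mul, norm_pow, Real.norm_eq_abs, sq_abs, abs_norm]
    rw [← hlaw, integrable_map_measure hqm.aestronglyMeasurable (hX.prodMk (hU' k))] at hq
    refine ((ih.const_mul 2).add (hq.const_mul (2 * h ^ 2))).mono'
      ((aemeasurable_iterate hft.2.1 hU' μ h x₀ (k + 1)).norm.pow_const 2).aestronglyMeasurable
      (Eventually.of_forall fun ω => ?_)
    rw [iterate_succ, Real.norm_of_nonneg (sq_nonneg _), oracleStep]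
    simp only [Function.comp, Pi.add_apply, hXdef]
    set x := iterate ft μ (fun _ => h) x₀ (fun j => U j ω) k
    set c := oracleSlope ft μ x (U k ω)
    have hle : ‖x - (h * c) • U k ω‖ ≤ ‖x‖ + |h * c| * ‖U k ω‖ :=
      (norm_sub_le _ _).trans_eq (by rw [norm_smul, Real.norm_eq_abs])
    calc _ ≤ (‖x‖ + |h * c| * ‖U k ω‖) ^ 2 := by gcongr
      _ ≤ 2 * ‖x‖ ^ 2 + 2 * (|h * c| ^ 2 * ‖U k ω‖ ^ 2) := by
        nlinarith [sq_nonneg (‖x‖ - |h * c| * ‖U k ω‖)]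
      _ = _ := by rw [sq_abs]; ring

lemma integrable_norm_fderiv_sq_iterate (hf : HasHolderGradient f ν L) (h0 : 0 ≤ ν) (h1 : ν ≤ 1)
    (hL : 0 ≤ L) (hμ : 0 < μ) (hn : 0 < Module.finrank ℝ E) (hft : IsInexactOracle f ft δ)
    (hU : ∀ k, HasLaw (U k) (stdGaussian E) P) (hind : iIndepFun U P) (h : ℝ) (x₀ : E) (k : ℕ) :
    Integrable (fun ω => ‖fderiv ℝ (smoothed f μ)
      (iterate ft μ (fun _ => h) x₀ (fun j => U j ω) k)‖ ^ 2) P := by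
  have hX := aemeasurable_iterate hft.2.1 (fun k => (hU k).aemeasurable) μ h x₀ k
  have hQ := (integrable_map_measure (g := fun x => ‖x‖ ^ 2) (by fun_prop) hX).2
    (integrable_norm_sq_iterate hf h0 h1 hL hμ hn hft hU hind h x₀ k)
  exact ((hf.smoothed_lipschitz h0 h1 hL hμ hn).integrable_norm_fderiv_sq hQ).comp_aemeasurable hX

lemma integrable_smoothed_iterate (hf : HasHolderGradient f ν L) (h0 : 0 ≤ ν) (h1 : ν ≤ 1)
    (hL : 0 ≤ L) (hμ : 0 < μ) (hn : 0 < Module.finrank ℝ E) (hft : IsInexactOracle f ft δ)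
    (hU : ∀ k, HasLaw (U k) (stdGaussian E) P) (hind : iIndepFun U P) (h : ℝ) (x₀ : E) (k : ℕ) :
    Integrable (fun ω => smoothed f μ (iterate ft μ (fun _ => h) x₀ (fun j => U j ω) k)) P := by
  have hX := aemeasurable_iterate hft.2.1 (fun k => (hU k).aemeasurable) μ h x₀ k
  have hlip := hf.smoothed_lipschitz h0 h1 hL hμ hn
  exact ((integrable_const _).add ((integrable_norm_sq_iterate hf h0 h1 hL hμ hn hft hU hind h x₀
    k).const_mul _)).mono' (hlip.measurable.comp_aemeasurable hX).aestronglyMeasurable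
    (Eventually.of_forall fun ω => hlip.abs_le _)

/-- Expected decrease of the smoothed function along the process. -/
lemma integral_smoothed_iterate_succ_le (hf : HasHolderGradient f ν L) (h0 : 0 ≤ ν) (h1 : ν ≤ 1)
    (hL : 0 ≤ L) (hμ : 0 < μ) (hn : 0 < Module.finrank ℝ E) (hft : IsInexactOracle f ft δ)
    (hU : ∀ k, HasLaw (U k) (stdGaussian E) P) (hind : iIndepFun U P)
    {h θ : ℝ} (hh : 0 ≤ h) (hθ : smoothConst ν L (Module.finrank ℝ E) μ * h = θ)
    (hθn : θ * (80 * Module.finrank ℝ E) ≤ 1) (x₀ : E) (k : ℕ) :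
    ∫ ω, smoothed f μ (iterate ft μ (fun _ => h) x₀ (fun j => U j ω) (k + 1)) ∂P ≤
      ∫ ω, smoothed f μ (iterate ft μ (fun _ => h) x₀ (fun j => U j ω) k) ∂P -
      h / 2 * ∫ ω, ‖fderiv ℝ (smoothed f μ)
        (iterate ft μ (fun _ => h) x₀ (fun j => U j ω) k)‖ ^ 2 ∂P +
      h * stepError ν L (Module.finrank ℝ E) μ δ θ := by
  have hU' := fun k => (hU k).aemeasurable
  have hX := aemeasurable_iterate hft.2.1 hU' μ h x₀ k
  have hlaw := map_iterate_prodMk hft.2.1 hU hind μ h x₀ k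
  have hlip := hf.smoothed_lipschitz h0 h1 hL hμ hn
  have hΦ := integrable_smoothed_iterate hf h0 h1 hL hμ hn hft hU hind h x₀ k
  have hΦ' := integrable_smoothed_iterate hf h0 h1 hL hμ hn hft hU hind h x₀ (k + 1)
  have hg := integrable_norm_fderiv_sq_iterate hf h0 h1 hL hμ hn hft hU hind h x₀ k
  simp_rw [iterate_succ] at hΦ' ⊢
  set X := fun ω => iterate ft μ (fun _ => h) x₀ (fun j => U j ω) k with hXdef
  have hprob : IsProbabilityMeasure (P.map X) := Measure.isProbabilityMeasure_map hX
  have hm : Measurable (fun p : E × E => smoothed f μ (oracleStep ft μ h p.1 p.2)) :=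
    hlip.measurable.comp (measurable_oracleStep hft.2.1 μ h)
  have hΦm : Integrable (smoothed f μ) (P.map X) :=
    (integrable_map_measure hlip.measurable.aestronglyMeasurable hX).2 hΦ
  have hgm : Integrable (fun x => ‖fderiv ℝ (smoothed f μ) x‖ ^ 2) (P.map X) :=
    (integrable_map_measure
      measurable_norm_fderiv_sq.aestronglyMeasurable hX).2 hg
  have hΦ'm : Integrable (fun p : E × E => smoothed f μ (oracleStep ft μ h p.1 p.2))
      ((P.map X).prod (stdGaussian E)) := by
    rw [← hlaw]
    exact (integrable_map_measure hm.aestronglyMeasurable (hX.prodMk (hU' k))).2 hΦ'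
  have e1 : ∫ ω, smoothed f μ (oracleStep ft μ h (X ω) (U k ω)) ∂P =
      ∫ x, ∫ u, smoothed f μ (oracleStep ft μ h x u) ∂(stdGaussian E) ∂(P.map X) := by
    rw [← integral_prod _ hΦ'm, ← hlaw,
      integral_map (hX.prodMk (hU' k)) hm.aestronglyMeasurable]
  have e2 : ∫ ω, smoothed f μ (X ω) ∂P = ∫ x, smoothed f μ x ∂(P.map X) :=
    (integral_map hX hlip.measurable.aestronglyMeasurable).symm
  have e3 : ∫ ω, ‖fderiv ℝ (smoothed f μ) (X ω)‖ ^ 2 ∂P =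
      ∫ x, ‖fderiv ℝ (smoothed f μ) x‖ ^ 2 ∂(P.map X) :=
    (integral_map hX measurable_norm_fderiv_sq.aestronglyMeasurable).symm
  have hg2 := hgm.const_mul (h / 2)
  have hc : Integrable (fun _ : E => h * stepError ν L (Module.finrank ℝ E) μ δ θ) (P.map X) :=
    integrable_const _
  have hfin := integral_mono hΦ'm.integral_prod_left ((hΦm.sub hg2).add hc) fun x =>
    integral_smoothed_oracleStep_le hf h0 h1 hL hμ hn hft hh hθ hθn x
  rw [integral_add' (hΦm.sub hg2) hc, integral_sub' hΦm hg2, integral_const_mul] at hfin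
  simp only [integral_const, probReal_univ, one_smul] at hfin
  change ∫ ω, smoothed f μ (oracleStep ft μ h (X ω) (U k ω)) ∂P ≤ ∫ ω, smoothed f μ (X ω) ∂P -
    h / 2 * ∫ ω, ‖fderiv ℝ (smoothed f μ) (X ω)‖ ^ 2 ∂P + _
  rw [e1, e2, e3]
  exact hfin

/-- The sum of the expected squared gradient norms along the process. -/
lemma sum_integral_norm_fderiv_sq_le (hf : HasHolderGradient f ν L) (h0 : 0 ≤ ν) (h1 : ν ≤ 1)
    (hL : 0 ≤ L) (hμ : 0 < μ) (hn : 0 < Module.finrank ℝ E) (hft : IsInexactOracle f ft δ)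
    (hU : ∀ k, HasLaw (U k) (stdGaussian E) P) (hind : iIndepFun U P)
    {h θ : ℝ} (hh : 0 ≤ h) (hθ : smoothConst ν L (Module.finrank ℝ E) μ * h = θ)
    (hθn : θ * (80 * Module.finrank ℝ E) ≤ 1) {m : ℝ} (hm : ∀ x, m ≤ f x) (x₀ : E) (N : ℕ) :
    h / 2 * ∑ k ∈ Finset.range N, ∫ ω, ‖fderiv ℝ (smoothed f μ)
        (iterate ft μ (fun _ => h) x₀ (fun j => U j ω) k)‖ ^ 2 ∂P ≤
      smoothed f μ x₀ - m + N * (h * stepError ν L (Module.finrank ℝ E) μ δ θ) := by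
  have hsm : ∀ x, m ≤ smoothed f μ x := fun x => by
    rw [smoothed_eq_integral]
    have := integral_mono (integrable_const m) (integrable_comp_affine (hf.expGrowth h0 h1 hL)
      hf.measurable x μ) fun u => hm (x + μ • u)
    simpa using this
  have hlow : m ≤ ∫ ω, smoothed f μ (iterate ft μ (fun _ => h) x₀ (fun j => U j ω) N) ∂P := by
    have := integral_mono (integrable_const m)
      (integrable_smoothed_iterate hf h0 h1 hL hμ hn hft hU hind h x₀ N) fun ω => hsm _
    simpa using this
  -- The lower bound `m` is replaced by the expectation at time N, so that the induction telescopes.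
  suffices h / 2 * ∑ k ∈ Finset.range N, ∫ ω, ‖fderiv ℝ (smoothed f μ)
        (iterate ft μ (fun _ => h) x₀ (fun j => U j ω) k)‖ ^ 2 ∂P ≤
      smoothed f μ x₀ - ∫ ω, smoothed f μ (iterate ft μ (fun _ => h) x₀ (fun j => U j ω) N) ∂P +
        N * (h * stepError ν L (Module.finrank ℝ E) μ δ θ) by linarith
  clear hlow
  induction N with
  | zero => simp [iterate]
  | succ N ih =>
    have := integral_smoothed_iterate_succ_le hf h0 h1 hL hμ hn hft hU hind hh hθ hθn x₀ N
    rw [Finset.sum_range_succ, mul_add]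
    push_cast
    linarith

end Iteration

/-! ### The choice of the smoothing parameter -/

section Parameters

/-- The smoothing parameter `μ` with `μ^(1+ν) n^(1+ν) = K`. -/
def smoothingParam (ν : ℝ) (n : ℕ) (K : ℝ) : ℝ := K ^ (1 / (1 + ν)) / n

variable {ν L K : ℝ} {n : ℕ}

lemma smoothingParam_pos (hn : 1 ≤ n) (hK : 0 < K) : 0 < smoothingParam ν n K := by
  unfold smoothingParam; positivity

lemma smoothingParam_rpow (hK : 0 < K) (t : ℝ) :
    smoothingParam ν n K ^ t = K ^ (t / (1 + ν)) / (n : ℝ) ^ t := by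
  rw [smoothingParam, Real.div_rpow (by positivity) (by positivity), ← Real.rpow_mul hK.le]
  congr 2
  ring

lemma smoothingParam_rpow_one_add (h0 : 0 ≤ ν) (hK : 0 < K) :
    smoothingParam ν n K ^ (1 + ν) = K / (n : ℝ) ^ (1 + ν) := by
  rw [smoothingParam_rpow hK, div_self (by positivity), Real.rpow_one]

lemma smoothingParam_lt_one (h0 : 0 ≤ ν) (hn : 1 ≤ n) (hK : 0 < K) (hK1 : K < 1) :
    smoothingParam ν n K < 1 := by
  have hn' : (1 : ℝ) ≤ n := by exact_mod_cast hn
  calc smoothingParam ν n K ≤ K ^ (1 / (1 + ν)) := div_le_self (by positivity) hn'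
    _ < 1 := Real.rpow_lt_one hK.le hK1 (by positivity)

lemma gapBound_smoothingParam (h0 : 0 ≤ ν) (hn : 1 ≤ n) (hK : 0 < K) :
    gapBound ν L n (smoothingParam ν n K) = L / (1 + ν) * (K / (n : ℝ) ^ ((1 + ν) / 2)) := by
  have hn' : (0 : ℝ) < n := by exact_mod_cast hn
  have e : (n : ℝ) ^ (1 + ν) = (n : ℝ) ^ ((1 + ν) / 2) * (n : ℝ) ^ ((1 + ν) / 2) := by
    rw [← Real.rpow_add hn']; ring_nf
  rw [gapBound, smoothingParam_rpow_one_add h0 hK, e]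
  have := Real.rpow_pos_of_pos hn' ((1 + ν) / 2)
  field_simp

lemma noiseBound_smoothingParam (hn : 1 ≤ n) (hK : 0 < K) :
    noiseBound ν n (smoothingParam ν n K) =
      K ^ ((5 - ν) / (2 * (1 + ν))) / (n : ℝ) ^ ((13 - 3 * ν) / 4) := by
  have hn' : (0 : ℝ) < n := by exact_mod_cast hn
  rw [noiseBound, smoothingParam_rpow hK, div_div, div_div, ← Real.rpow_add hn']
  ring_nf

lemma smoothConst_pos {μ : ℝ} (hL : 0 < L) (hn : 1 ≤ n) (hμ : 0 < μ) :
    0 < smoothConst ν L n μ := by unfold smoothConst; positivity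

lemma stepSize_pos {μ : ℝ} (hL : 0 < L) (hn : 1 ≤ n) (hμ : 0 < μ) : 0 < stepSize ν L n μ := by
  have := smoothConst_pos (ν := ν) hL hn hμ
  unfold stepSize; positivity

lemma smoothConst_mul_stepSize {μ : ℝ} (hL : 0 < L) (hn : 1 ≤ n) (hμ : 0 < μ) :
    smoothConst ν L n μ * stepSize ν L n μ = μ ^ (1 - ν) / (80 * ((n : ℝ) + 4)) := by
  have := smoothConst_pos (ν := ν) hL hn hμ
  rw [stepSize]
  field_simp

/-- The noise bound gives (δ/μ)² ≤ μ^(3-ν) ≤ μ^(1+ν) ≤ K, as μ < 1 and ν ≤ 1. In the smoothing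
error, θ supplies μ^(1-ν)/n, which turns μ^(2ν) n^(2+ν) into (μn)^(1+ν) = K. -/
lemma stepError_le {δ : ℝ} (h0 : 0 ≤ ν) (h1 : ν ≤ 1) (hn : 1 ≤ n) (hK : 0 < K) (hK1 : K < 1)
    (hδ : 0 < δ) (hδn : δ < noiseBound ν n (smoothingParam ν n K)) :
    stepError ν L n (smoothingParam ν n K) δ
      (smoothingParam ν n K ^ (1 - ν) / (80 * ((n : ℝ) + 4))) ≤ 5 * (1 + L ^ 2) * K := by
  have hn' : (1 : ℝ) ≤ n := by exact_mod_cast hn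
  have hn0 : (0 : ℝ) < n := by linarith
  have hμ := smoothingParam_pos (ν := ν) hn hK
  have hμ1 := smoothingParam_lt_one h0 hn hK hK1
  have hμK := smoothingParam_rpow_one_add (n := n) h0 hK
  set μ := smoothingParam ν n K
  have hpow1 : 1 ≤ (n : ℝ) ^ (1 + ν) := Real.one_le_rpow hn' (by positivity)
  have hμK' : μ ^ (1 + ν) ≤ K := by rw [hμK]; exact div_le_self hK.le hpow1
  have hd : (δ / μ) ^ 2 ≤ K := by
    have h2 : δ / μ ≤ μ ^ ((3 - ν) / 2) := by
      rw [div_le_iff₀ hμ, ← Real.rpow_add_one hμ.ne']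
      refine hδn.le.trans ((div_le_self (by positivity)
        (Real.one_le_rpow hn' (by linarith))).trans_eq ?_)
      ring_nf
    calc (δ / μ) ^ 2 ≤ (μ ^ ((3 - ν) / 2)) ^ 2 := by gcongr
      _ = μ ^ (3 - ν) := by
        rw [← Real.rpow_natCast, ← Real.rpow_mul hμ.le]
        congr 1
        push_cast
        ring
      _ ≤ μ ^ (1 + ν) := Real.rpow_le_rpow_of_exponent_ge hμ hμ1.le (by linarith)
      _ ≤ K := hμK'
  have hM1 : μ ^ (1 - ν) ≤ 1 := Real.rpow_le_one hμ.le hμ1.le (by linarith)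
  have hθ : μ ^ (1 - ν) / (80 * ((n : ℝ) + 4)) ≤ μ ^ (1 - ν) / (80 * n) := by
    gcongr
    linarith
  have hprod : μ ^ (1 - ν) * (μ ^ ν) ^ 2 * ((n : ℝ) * (n : ℝ) ^ ν) = K := by
    have e1 : μ ^ (1 - ν) * (μ ^ ν) ^ 2 = μ ^ (1 + ν) := by
      rw [← Real.rpow_natCast (μ ^ ν), ← Real.rpow_mul hμ.le, ← Real.rpow_add hμ]
      congr 1
      push_cast
      ring
    have e2 : (n : ℝ) * (n : ℝ) ^ ν = (n : ℝ) ^ (1 + ν) := by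
      rw [Real.rpow_add hn0, Real.rpow_one]
    rw [e1, e2, hμK]
    field_simp
  rw [stepError]
  calc _ ≤ 4 * K + μ ^ (1 - ν) / (80 * n) / 2 *
        (448 * L ^ 2 * (μ ^ ν) ^ 2 * (n : ℝ) ^ 2 * (n : ℝ) ^ ν + 16 * n * K) := by gcongr
    _ = 4 * K + 2.8 * L ^ 2 * (μ ^ (1 - ν) * (μ ^ ν) ^ 2 * ((n : ℝ) * (n : ℝ) ^ ν)) +
        μ ^ (1 - ν) * K / 10 := by
        field_simp
        ring
    _ ≤ 4 * K + 2.8 * L ^ 2 * K + 1 * K / 10 := by rw [hprod]; gcongr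
    _ ≤ _ := by nlinarith [mul_nonneg (sq_nonneg L) hK.le]

/-- One factor μ^(1-ν) comes from D and another from 1/A₁. The powers of n add up to 2(1-ν) + 1 +
(1+ν)/2, and n + 4 ≤ 5n accounts for 400 = 80 · 5. -/
lemma le_stepSize_smoothingParam (hn : 1 ≤ n) (hL : 0 < L) (hK : 0 < K) :
    K ^ (2 * (1 - ν) / (1 + ν)) / (400 * L * (n : ℝ) ^ ((7 - 3 * ν) / 2)) ≤
      stepSize ν L n (smoothingParam ν n K) := by
  have hn' : (1 : ℝ) ≤ n := by exact_mod_cast hn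
  have hn0 : (0 : ℝ) < n := by linarith
  have hμ := smoothingParam_pos (ν := ν) hn hK
  have e1 : smoothingParam ν n K ^ (1 - ν) * smoothingParam ν n K ^ (1 - ν) =
      K ^ (2 * (1 - ν) / (1 + ν)) / (n : ℝ) ^ (2 * (1 - ν)) := by
    rw [← Real.rpow_add hμ, smoothingParam_rpow hK]
    ring_nf
  have e2 : (n : ℝ) ^ ((7 - 3 * ν) / 2) =
      (n : ℝ) ^ (2 * (1 - ν)) * n * (n : ℝ) ^ ((1 + ν) / 2) := by
    rw [← Real.rpow_add_one hn0.ne', ← Real.rpow_add hn0]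
    ring_nf
  have hM := Real.rpow_pos_of_pos hμ (1 - ν)
  rw [stepSize, smoothConst]
  calc _ = (K ^ (2 * (1 - ν) / (1 + ν)) / (n : ℝ) ^ (2 * (1 - ν))) /
        (80 * (5 * n) * (L * (n : ℝ) ^ ((1 + ν) / 2))) := by
        rw [e2]
        field_simp
        ring
    _ ≤ (K ^ (2 * (1 - ν) / (1 + ν)) / (n : ℝ) ^ (2 * (1 - ν))) /
        (80 * (n + 4) * (L * (n : ℝ) ^ ((1 + ν) / 2))) := by
        gcongr
        linarith
    _ = _ := by
        rw [← e1]
        field_simp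

end Parameters

end ZerothOrder

end

/-! ### The convergence theorem -/

theorem theorem2 (ν L Δ εmax : ℝ) (hν₀ : 0 ≤ ν) (hν₁ : ν ≤ 1) (hL : 0 < L) (hΔ : 0 ≤ Δ)
    (hεmax : 0 < εmax) :
    -- The constants hidden in the asymptotic notation depend on `ν`, `L`, `Δ` and `εmax` only.
    ∃ cN cδ c₁ c₂ : ℝ, 0 < cN ∧ 0 < cδ ∧ 0 < c₁ ∧ 0 < c₂ ∧
      ∀ n : ℕ, 1 ≤ n → ∀ ε : ℝ, 0 < ε → ε ≤ εmax →
      -- The smoothing parameter depends on the target accuracy and the dimension, not on `f`.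
      ∃ μ : ℝ, 0 < μ ∧ μ < 1 ∧
        c₁ * (ε / (n : ℝ) ^ ((1 + ν) / 2)) ≤ ZerothOrder.gapBound ν L n μ ∧
        ZerothOrder.gapBound ν L n μ ≤ c₂ * (ε / (n : ℝ) ^ ((1 + ν) / 2)) ∧
        ZerothOrder.noiseBound ν n μ ≤
          cδ * (ε ^ ((5 - ν) / (2 * (1 + ν))) / (n : ℝ) ^ ((13 - 3 * ν) / 4)) ∧
        ∀ (E : Type u) [NormedAddCommGroup E] [InnerProductSpace ℝ E] [FiniteDimensional ℝ E]
          [MeasurableSpace E] [BorelSpace E], Module.finrank ℝ E = n →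
        ∀ f : E → ℝ, ZerothOrder.HasHolderGradient f ν L → BddBelow (Set.range f) →
          -- The smoothed function is well defined and differentiable, and uniformly close to `f`.
          (∀ x : E, Integrable (fun w : E => f (x + μ • w) * Real.exp (-(1 / 2) * ‖w‖ ^ 2))) ∧
          Differentiable ℝ (ZerothOrder.smoothed f μ) ∧
          (∀ x : E, |ZerothOrder.smoothed f μ x - f x| ≤ ZerothOrder.gapBound ν L n μ) ∧
          -- Convergence of the process with an inexact oracle.
          ∀ (δ : ℝ) (ft : E → ℝ), ZerothOrder.IsInexactOracle f ft δ →
            δ < ZerothOrder.noiseBound ν n μ →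
          ∀ x₀ : E, f x₀ - ⨅ x : E, f x ≤ Δ →
          ∀ (Ω : Type v) [MeasurableSpace Ω] (P : Measure Ω) [IsProbabilityMeasure P]
            (U : ℕ → Ω → E), (∀ k, HasLaw (U k) (stdGaussian E) P) → iIndepFun U P →
          (∀ k : ℕ, Integrable (fun ω => ‖fderiv ℝ (ZerothOrder.smoothed f μ)
            (ZerothOrder.iterate ft μ (fun _ => ZerothOrder.stepSize ν L n μ) x₀
              (fun j => U j ω) k)‖ ^ 2) P) ∧
          ∀ N : ℕ, cN * ((n : ℝ) ^ ((7 - 3 * ν) / 2) / ε ^ ((3 - ν) / (1 + ν))) ≤ N →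
            ∃ k < N, ∫ ω, ‖fderiv ℝ (ZerothOrder.smoothed f μ)
              (ZerothOrder.iterate ft μ (fun _ => ZerothOrder.stepSize ν L n μ) x₀
                (fun j => U j ω) k)‖ ^ 2 ∂P ≤ ε := by
  open ZerothOrder in
  have hs : 0 < 1 + ν := by positivity
  -- With K = aε, the factor 20(1 + L²) brings the step error down to ε/4, and 1 + εmax keeps K, and
  -- hence μ, below 1 for every admissible ε.
  set a : ℝ := 1 / (20 * (1 + L ^ 2) * (1 + εmax)) with ha_def
  have ha : 0 < a := by positivity
  set p : ℝ := 2 * (1 - ν) / (1 + ν) with hp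
  -- Here 1600 = 4 · 400 combines the ε/4 with the step-size bound, and Δ + L bounds f_μ(x₀) - f*.
  -- The gap is exactly proportional to ε/n^((1+ν)/2), so c₁ = c₂.
  refine ⟨1600 * L * (Δ + L) / a ^ p, a ^ ((5 - ν) / (2 * (1 + ν))), L / (1 + ν) * a,
    L / (1 + ν) * a, by positivity, by positivity, by positivity, by positivity, ?_⟩
  intro n hn ε hε hεm
  have hn' : (1 : ℝ) ≤ n := by exact_mod_cast hn
  set K : ℝ := a * ε with hK_def
  have hK : 0 < K := by positivity
  have hKε : 5 * (1 + L ^ 2) * K ≤ ε / 4 := by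
    have e : 5 * (1 + L ^ 2) * K = ε / 4 / (1 + εmax) := by
      rw [hK_def, ha_def]
      field_simp
      ring
    rw [e]
    exact div_le_self (by positivity) (by linarith)
  have hK1 : K < 1 := by
    have h1 : K ≤ εmax / (20 * (1 + L ^ 2) * (1 + εmax)) := by
      rw [hK_def, ha_def, one_div_mul_eq_div]
      gcongr
    refine h1.trans_lt ((div_lt_one (by positivity)).2 ?_)
    nlinarith [mul_nonneg (sq_nonneg L) hεmax.le, sq_nonneg L]
  have hμ := smoothingParam_pos (ν := ν) hn hK
  have hμ1 := smoothingParam_lt_one hν₀ hn hK hK1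
  have hgap := gapBound_smoothingParam (L := L) hν₀ hn hK
  refine ⟨smoothingParam ν n K, hμ, hμ1, ?_, ?_, ?_, ?_⟩
  · rw [hgap, hK_def]
    exact le_of_eq (by ring)
  · rw [hgap, hK_def]
    exact le_of_eq (by ring)
  · rw [noiseBound_smoothingParam hn hK, hK_def, Real.mul_rpow ha.le hε.le, mul_div_assoc]
  intro E _ _ _ _ _ hdim f hf hbdd
  have hdim0 : 0 < Module.finrank ℝ E := by omega
  have hgapE : ∀ x : E, |smoothed f (smoothingParam ν n K) x - f x| ≤
      gapBound ν L n (smoothingParam ν n K) := fun x => by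
    have := hf.abs_smoothed_sub_le hν₀ hν₁ hL.le hμ.le hdim0 x
    rwa [hdim] at this
  refine ⟨fun x => ?_, ?_, hgapE, ?_⟩
  · exact integrable_mul_exp_of_integrable_stdGaussian
      (integrable_comp_affine (hf.expGrowth hν₀ hν₁ hL.le) hf.measurable x _)
  · exact fun x => (hf.hasFDerivAt_smoothed hν₀ hν₁ hL.le _ x).differentiableAt
  intro δ ft hft hδ x₀ hx₀ Ω _ P _ U hU hind
  refine ⟨fun k => integrable_norm_fderiv_sq_iterate hf hν₀ hν₁ hL.le hμ hdim0 hft hU hind _ x₀ k,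
    ?_⟩
  intro N hN
  -- If all N expectations exceeded ε, the sum bound would give Nhε/2 < Δ + L + Nhε/4, whereas the
  -- choice of N ensures Nhε/4 ≥ Δ + L.
  by_contra! hcon
  have hNpos : (0 : ℝ) < N := lt_of_lt_of_le (by positivity) hN
  have hh := stepSize_pos (ν := ν) hL hn hμ
  have hθ := smoothConst_mul_stepSize (ν := ν) hL hn hμ
  have hθn : smoothingParam ν n K ^ (1 - ν) / (80 * ((n : ℝ) + 4)) * (80 * n) ≤ 1 := by
    have hM1 : smoothingParam ν n K ^ (1 - ν) ≤ 1 := Real.rpow_le_one hμ.le hμ1.le (by linarith)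
    rw [div_mul_eq_mul_div, div_le_one (by positivity)]
    nlinarith
  have hR := stepError_le (L := L) hν₀ hν₁ hn hK hK1 hft.1 hδ
  have hle := le_stepSize_smoothingParam (ν := ν) hn hL hK
  have hsum := sum_integral_norm_fderiv_sq_le (h := stepSize ν L n (smoothingParam ν n K))
    (θ := smoothingParam ν n K ^ (1 - ν) / (80 * ((n : ℝ) + 4)))
    hf hν₀ hν₁ hL.le hμ hdim0 hft hU hind hh.le (by rwa [hdim])
    (by rwa [hdim]) (fun x => ciInf_le hbdd x) x₀ N
  rw [hdim] at hsum
  have hgap0 := (abs_le.1 (hgapE x₀)).2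
  have hgapL : gapBound ν L n (smoothingParam ν n K) ≤ L := by
    rw [hgap]
    have h1 : L / (1 + ν) ≤ L := div_le_self hL.le (by linarith)
    have h2 : K / (n : ℝ) ^ ((1 + ν) / 2) ≤ 1 :=
      (div_le_self hK.le (Real.one_le_rpow hn' (by positivity))).trans hK1.le
    calc _ ≤ L * 1 := by gcongr
      _ = L := mul_one L
  set h := stepSize ν L n (smoothingParam ν n K)
  have hlow : N * ε < ∑ k ∈ Finset.range N, ∫ ω, ‖fderiv ℝ (smoothed f (smoothingParam ν n K))
      (iterate ft (smoothingParam ν n K) (fun _ => h) x₀ (fun j => U j ω) k)‖ ^ 2 ∂P := by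
    have hN0 : (Finset.range N).Nonempty :=
      Finset.nonempty_range_iff.2 (Nat.cast_pos.1 hNpos).ne'
    have := Finset.sum_lt_sum_of_nonempty hN0 fun k hk => hcon k (Finset.mem_range.1 hk)
    simpa using this
  have hlow2 := mul_lt_mul_of_pos_left hlow (by positivity : 0 < h / 2)
  have hRh : N * (h * stepError ν L n (smoothingParam ν n K) δ
      (smoothingParam ν n K ^ (1 - ν) / (80 * ((n : ℝ) + 4)))) ≤ N * (h * (ε / 4)) := by
    gcongr
    exact hR.trans hKε
  have hNh : Δ + L ≤ N * (h * (ε / 4)) := by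
    have hq : 0 < (n : ℝ) ^ ((7 - 3 * ν) / 2) := by positivity
    have e : ε ^ ((3 - ν) / (1 + ν)) = ε ^ p * ε := by
      rw [← Real.rpow_add_one hε.ne', hp]
      congr 1
      field_simp
      ring
    rw [hK_def, Real.mul_rpow ha.le hε.le, ← hp] at hle
    calc Δ + L = (1600 * L * (Δ + L) / a ^ p *
          ((n : ℝ) ^ ((7 - 3 * ν) / 2) / ε ^ ((3 - ν) / (1 + ν)))) *
          ((a ^ p * ε ^ p / (400 * L * (n : ℝ) ^ ((7 - 3 * ν) / 2))) * (ε / 4)) := by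
          rw [e]
          have := Real.rpow_pos_of_pos ha p
          have := Real.rpow_pos_of_pos hε p
          field_simp
          ring
      _ ≤ _ := by gcongr
  linarith
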